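/- Let $\mathcal Z_d = T^*\mathbb R^{2d^2}$, identified with the space $\mathsf M_{2d}(\mathbb R)$ of real block matrices $Z=\begin{bmatrix} Q_1 & Q_2\\ P_1 & P_2\end{bmatrix}$ with $d\times d$ blocks, where $[Q_1\ Q_2]\in \mathsf M_{d\times 2d}(\mathbb R)\cong\mathbb R^{2d^2}$ is the base point and $[P_1\ P_2]$ the covector. Equip it with the canonical one-form $\Theta=\operatorname{tr}(P_1^T\mathbf dQ_1)+\operatorname{tr}(P_2^T\mathbf dQ_2)$ and the two-form $\Omega_{\mathcal Z_d}=\sum_{j,k}\big(\mathbf dQ_1^{jk}\wedge\mathbf dP_{1,jk}+\mathbf dQ_2^{jk}\wedge\mathbf dP_{2,jk}\big)$ (with $\alpha\wedge\beta=\alpha\otimes\beta-\beta\otimes\alpha$ for one-forms). Let $\mathsf O(2d)$ act by $(\mathcal R,Z)\mapsto Z\mathcal R$, let $\mathbf M\colon\mathcal Z_d\to\mathfrak o(2d)^*$ be given by $\langle\mathbf M(Z),\xi\rangle=\Theta_Z(Z\xi)$, map $\mathfrak o(2d)$ to $\mathfrak o(2d)^*$ by the inner product $\langle\xi,\eta\rangle=\frac12\operatorname{tr}(\xi^T\eta)$,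 let $\langle \mathrm{Ad}^*_{\mathcal R}\mu,\xi\rangle=\langle\mu,\mathcal R\xi\mathcal R^{-1}\rangle$, let $J=\begin{bmatrix}0&I_d\\-I_d&0\end{bmatrix}\in\mathfrak o(2d)\cong\mathfrak o(2d)^*$, and let $\mathsf O(2d)_J=\{\mathcal R\in\mathsf O(2d):\mathrm{Ad}^*_{\mathcal R}J=J\}$. Let $\Sigma_d$ be the set of complex symmetric $d\times d$ matrices $\mathcal C=\mathcal A+\mathrm i\mathcal B$ with $\mathcal B>0$, an open subset of the real vector space of complex symmetric matrices, with the two-form $\Omega_{\Sigma_d}=\operatorname{Im}\operatorname{tr}\big(\mathcal B^{-1}\mathbf d\mathcal C\,\mathcal B^{-1}\mathbf d\bar{\mathcal C}\big)=-\sum_{j,k}\mathbf d(\mathcal B^{-1})_{jk}\wedge\mathbf d\mathcal A_{jk}$. Then: 1. $\Omega_{\mathcal Z_d}=-\mathbf d\Theta$ is a symplectic form, and the action preserves $\Theta$ and $\Omega_{\mathcal Z_d}$. The infinitesimal generator of $\xi\in\mathfrak o(2d)$ is $\xi_{\mathcal Z_d}(Z)=\frac{d}{d\varepsilon}\big|_{\varepsilon=0}Ze^{\varepsilon\xi}=Z\xi$,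 and $\mathbf M$ is an equivariant momentum map: $\mathbf d\langle\mathbf M,\xi\rangle=\Omega_{\mathcal Z_d}(\xi_{\mathcal Z_d},\cdot)$ and $\mathbf M(Z\mathcal R)=\mathrm{Ad}^*_{\mathcal R}\mathbf M(Z)$. The map $\mathfrak o(2d)\to\mathfrak o(2d)^*$ above is bijective, and under it $$\mathbf M(Z)=\begin{bmatrix}Q_1^TP_1-P_1^TQ_1 & Q_1^TP_2-P_1^TQ_2\\ -(Q_1^TP_2-P_1^TQ_2)^T & Q_2^TP_2-P_2^TQ_2\end{bmatrix}.$$ 2. $\mathbf M^{-1}(J)=\mathsf{Sp}(2d,\mathbb R)$, and $J$ is a regular value of $\mathbf M$. 3. $\mathsf O(2d)_J=\mathsf{Sp}(2d,\mathbb R)\cap\mathsf O(2d)$, and $\begin{bmatrix}U&V\\-V&U\end{bmatrix}\mapsto U+\mathrm iV$ is an isomorphism of topological groups from $\mathsf O(2d)_J$ onto $\mathsf U(d)$. In particular $\mathsf O(2d)_J$ is compact; it acts freely on $\mathbf M^{-1}(J)$. 4. Let $\overline{\mathcal Z}_d^J=\mathbf M^{-1}(J)/\mathsf O(2d)_J$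 be the Marsden--Weinstein quotient, $i_J\colon\mathbf M^{-1}(J)\hookrightarrow\mathcal Z_d$ the inclusion and $\pi_J\colon\mathbf M^{-1}(J)\to\overline{\mathcal Z}_d^J$ the projection. Then $[S]\mapsto[S]$ is a homeomorphism from $\overline{\mathcal Z}_d^J$ onto the space of left cosets $\mathsf{Sp}(2d,\mathbb R)/(\mathsf{Sp}(2d,\mathbb R)\cap\mathsf O(2d))=\mathsf{Sp}(2d,\mathbb R)/\mathsf U(d)$. With the subspace topology $\mathbf M^{-1}(J)$ has a smooth manifold structure, of dimension $d(2d+1)$, for which $i_J$ is a smooth immersion, and with the quotient topology $\overline{\mathcal Z}_d^J$ has a smooth manifold structure for which $\pi_J$ is a smooth submersion. For these structures, $$\begin{bmatrix}A&B\\C&D\end{bmatrix}\longmapsto (C+\mathrm iD)(A+\mathrm iB)^{-1}$$ (where $A+\mathrm iB$ is always invertible) induces a diffeomorphism $\overline{\mathcal Z}_d^J\to\Sigma_d$. 5. $\Omega_{\Sigma_d}$ is a symplectic form on $\Sigma_d$, and there is exactly one two-form $\overline\Omega_J$ on $\overline{\mathcal Z}_d^J$ with $\pi_J^*\overline\Omega_J=i_J^*\Omega_{\mathcal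 Z_d}$; under the diffeomorphism in 4 it is $\overline\Omega_J=-\frac12\,\Omega_{\Sigma_d}$. -/

import Mathlib

open Matrix
open scoped Manifold ContDiff Matrix.Norms.L2Operator

namespace SiegelReduction

noncomputable section

/-! ### The phase space `Z_d = T^* M_{d × 2d}(ℝ) ≅ M_{2d}(ℝ)` -/

/-- The phase space.  A point is a block matrix `Z = [Q₁ Q₂; P₁ P₂]`: the upper half `[Q₁ Q₂]` is the
base point in `M_{d × 2d}(ℝ)`, the lower half `[P₁ P₂]` is the covector, paired with tangent vectors
`[V₁ V₂]` of the base by `tr (P₁ᵀ V₁) + tr (P₂ᵀ V₂)`.  The norm of the scope `Matrix.Norms.L2Operator`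
is used to speak of derivatives; all norms are equivalent. -/
abbrev Phase (d : ℕ) : Type := Matrix (Fin d ⊕ Fin d) (Fin d ⊕ Fin d) ℝ

/-- The canonical one-form `Θ_Z(X) = tr (P₁ᵀ dQ₁(X)) + tr (P₂ᵀ dQ₂(X))`. -/
def Theta {d : ℕ} (Z : Phase d) : Phase d →L[ℝ] ℝ :=
  LinearMap.toContinuousLinearMap
    { toFun := fun X =>
        (Z.toBlocks₂₁ᵀ * X.toBlocks₁₁).trace + (Z.toBlocks₂₂ᵀ * X.toBlocks₁₂).trace
      map_add' := fun X Y => by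
        have h1 : (X + Y).toBlocks₁₁ = X.toBlocks₁₁ + Y.toBlocks₁₁ := rfl
        have h2 : (X + Y).toBlocks₁₂ = X.toBlocks₁₂ + Y.toBlocks₁₂ := rfl
        rw [h1, h2, Matrix.mul_add, Matrix.mul_add, Matrix.trace_add, Matrix.trace_add]
        ring
      map_smul' := fun c X => by
        have h1 : (c • X).toBlocks₁₁ = c • X.toBlocks₁₁ := rfl
        have h2 : (c • X).toBlocks₁₂ = c • X.toBlocks₁₂ := rfl
        rw [h1, h2, Matrix.mul_smul, Matrix.mul_smul, Matrix.trace_smul, Matrix.trace_smul]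
        simp [mul_add] }

/-- The two-form `(v, w) ↦ b v w` of an alternating bilinear form on a finite dimensional space. -/
def twoForm {E : Type*} [NormedAddCommGroup E] [NormedSpace ℝ E] [FiniteDimensional ℝ E]
    (b : E →ₗ[ℝ] E →ₗ[ℝ] ℝ) (hb : ∀ v, b v v = 0) : E [⋀^Fin 2]→L[ℝ] ℝ :=
  { toFun := fun v => b (v 0) (v 1)
    map_update_add' := by
      intro _ v i x y
      fin_cases i <;> simp [Function.update]
    map_update_smul' := by
      intro _ v i c x
      fin_cases i <;> simp [Function.update]
    map_eq_zero_of_eq' := by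
      intro v i j hv hij
      fin_cases i <;> fin_cases j <;> simp_all
    cont := by
      have h : Continuous fun p : E × E => b p.1 p.2 := by
        have : Continuous fun p : E × E =>
            (LinearMap.toContinuousLinearMap
              ((LinearMap.toContinuousLinearMap (𝕜 := ℝ) (E := E) (F' := ℝ)).toLinearMap ∘ₗ b)) p.1
              p.2 := by fun_prop
        exact this
      have h2 : Continuous fun v : Fin 2 → E => (v 0, v 1) := by fun_prop
      exact h.comp h2 }

/-- The standard symplectic form
`Ω_Z = dQ₁ ∧ dP₁ + dQ₂ ∧ dP₂ = ∑ dQ₁^{jk} ∧ dP₁^{jk} + ∑ dQ₂^{jk} ∧ dP₂^{jk}`. -/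
def OmegaZ (d : ℕ) : Phase d [⋀^Fin 2]→L[ℝ] ℝ :=
  twoForm
    (LinearMap.mk₂ ℝ
      (fun X Y : Phase d =>
        ∑ j, ∑ k,
          ((X.toBlocks₁₁ j k * Y.toBlocks₂₁ j k - Y.toBlocks₁₁ j k * X.toBlocks₂₁ j k) +
            (X.toBlocks₁₂ j k * Y.toBlocks₂₂ j k - Y.toBlocks₁₂ j k * X.toBlocks₂₂ j k)))
      (by
        intro X X' Y
        simp only [← Finset.sum_add_distrib]
        refine Finset.sum_congr rfl fun j _ => Finset.sum_congr rfl fun k _ => ?_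
        simp only [toBlocks₁₁, toBlocks₁₂, toBlocks₂₁, toBlocks₂₂, of_apply, Matrix.add_apply]
        ring)
      (by
        intro c X Y
        simp only [smul_eq_mul, Finset.mul_sum]
        refine Finset.sum_congr rfl fun j _ => Finset.sum_congr rfl fun k _ => ?_
        simp only [toBlocks₁₁, toBlocks₁₂, toBlocks₂₁, toBlocks₂₂, of_apply, Matrix.smul_apply,
          smul_eq_mul]
        ring)
      (by
        intro X Y Y'
        simp only [← Finset.sum_add_distrib]
        refine Finset.sum_congr rfl fun j _ => Finset.sum_congr rfl fun k _ => ?_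
        simp only [toBlocks₁₁, toBlocks₁₂, toBlocks₂₁, toBlocks₂₂, of_apply, Matrix.add_apply]
        ring)
      (by
        intro c X Y
        simp only [smul_eq_mul, Finset.mul_sum]
        refine Finset.sum_congr rfl fun j _ => Finset.sum_congr rfl fun k _ => ?_
        simp only [toBlocks₁₁, toBlocks₁₂, toBlocks₂₁, toBlocks₂₂, of_apply, Matrix.smul_apply,
          smul_eq_mul]
        ring))
    (by intro X; simp)

/-- A symplectic form on an open subset `U` of a finite dimensional vector space: a smooth, closed,
nondegenerate two-form. -/
def IsSymplecticOn {E : Type*} [NormedAddCommGroup E] [NormedSpace ℝ E]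
    (η : E → E [⋀^Fin 2]→L[ℝ] ℝ) (U : Set E) : Prop :=
  ContDiffOn ℝ ∞ η U ∧ (∀ x ∈ U, extDeriv η x = 0) ∧
    ∀ x ∈ U, ∀ v, (∀ w, η x ![v, w] = 0) → v = 0

/-! ### The right action of `O(2d)`, its momentum map, and the coadjoint action -/

/-- The orthogonal group `O(2d)`; it acts on `Phase d` by `(R, Z) ↦ Z * R`. -/
abbrev O (d : ℕ) : Type := Matrix.orthogonalGroup (Fin d ⊕ Fin d) ℝ

/-- The Lie algebra `o(2d)` of skew-symmetric matrices. -/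
abbrev o (d : ℕ) : Type := LieAlgebra.Orthogonal.so (Fin d ⊕ Fin d) ℝ

/-- The infinitesimal generator of `ξ ∈ o(2d)` at `Z`, that is, `d/dε (Z * exp (ε ξ))` at `ε = 0`. -/
def generator {d : ℕ} (ξ : o d) (Z : Phase d) : Phase d := Z * (ξ : Phase d)

/-- The momentum map `M : Z_d → o(2d)^*` of the action, `⟨M(Z), ξ⟩ = Θ_Z(ξ_Z(Z))`. -/
def momentum {d : ℕ} (Z : Phase d) : Module.Dual ℝ (o d) where
  toFun ξ := Theta Z (generator ξ Z)
  map_add' ξ η := by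
    rw [← map_add]
    exact congrArg _ (Matrix.mul_add Z (ξ : Phase d) (η : Phase d))
  map_smul' c ξ := by
    rw [RingHom.id_apply, ← map_smul]
    exact congrArg _ (Matrix.mul_smul Z c (ξ : Phase d))

/-- The map `o(2d) → o(2d)^*` given by the inner product `⟨ξ, η⟩ = ½ tr (ξᵀ η)`. -/
def toDual {d : ℕ} : o d →ₗ[ℝ] Module.Dual ℝ (o d) :=
  LinearMap.mk₂ ℝ (fun ξ η : o d => (1 / 2 : ℝ) * ((ξ : Phase d)ᵀ * (η : Phase d)).trace)
    (by intro ξ ξ' η; simp [Matrix.add_mul, mul_add])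
    (by intro c ξ η; simp; ring)
    (by intro ξ η η'; simp [mul_add])
    (by intro c ξ η; simp; ring)

/-- The adjoint action `Ad_R ξ = R ξ R⁻¹` of `O(2d)` on `o(2d)`. -/
def Ad {d : ℕ} (R : O d) : o d →ₗ[ℝ] o d where
  toFun ξ := ⟨(R : Phase d) * (ξ : Phase d) * ((R⁻¹ : O d) : Phase d), by
    have hξ : (ξ : Phase d)ᵀ = -(ξ : Phase d) := (LieAlgebra.Orthogonal.mem_so _ _ _).1 ξ.2
    have hR : ((R⁻¹ : O d) : Phase d) = (R : Phase d)ᵀ := rfl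
    rw [LieAlgebra.Orthogonal.mem_so, hR]
    simp [Matrix.transpose_mul, hξ, Matrix.mul_assoc]⟩
  map_add' ξ η := Subtype.ext (by simp [Matrix.mul_add, Matrix.add_mul])
  map_smul' c ξ := Subtype.ext (by simp)

/-- The coadjoint action `Ad_R^*` on `o(2d)^*`, `⟨Ad_R^* μ, ξ⟩ = ⟨μ, Ad_R ξ⟩`. -/
def coAd {d : ℕ} (R : O d) : Module.Dual ℝ (o d) →ₗ[ℝ] Module.Dual ℝ (o d) :=
  (Ad R).dualMap

/-- The element `J = [0 I; -I 0]` of `o(2d)`. -/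
def J (d : ℕ) : o d :=
  ⟨fromBlocks 0 1 (-1) 0, by
    rw [LieAlgebra.Orthogonal.mem_so]
    simp [fromBlocks_transpose, fromBlocks_neg]⟩

/-- `J` as an element of `o(2d)^*`. -/
def Jdual (d : ℕ) : Module.Dual ℝ (o d) := toDual (J d)

/-- The coadjoint isotropy group `O(2d)_J`. -/
def isotropy (d : ℕ) : Subgroup (O d) where
  carrier := {R | coAd R (Jdual d) = Jdual d}
  one_mem' := by
    have h : Ad (1 : O d) = LinearMap.id := LinearMap.ext fun ξ => Subtype.ext (by simp [Ad])
    simp [coAd, h]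
  mul_mem' := by
    intro R R' h h'
    have hm : Ad (R * R') = Ad R ∘ₗ Ad R' :=
      LinearMap.ext fun ξ => Subtype.ext (by
        simp [Ad, Matrix.mul_assoc])
    have hc : ∀ μ, coAd (R * R') μ = coAd R' (coAd R μ) := by
      intro μ
      refine LinearMap.ext fun ξ => ?_
      change μ (Ad (R * R') ξ) = μ (Ad R (Ad R' ξ))
      rw [hm, LinearMap.comp_apply]
    simp only [Set.mem_ofPred_eq] at h h' ⊢
    rw [hc, h, h']
  inv_mem' := by
    intro R h
    have hm : Ad R ∘ₗ Ad R⁻¹ = LinearMap.id :=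
      LinearMap.ext fun ξ => Subtype.ext (by
        have h1 : (R : Phase d) * ((R⁻¹ : O d) : Phase d) = 1 := by
          rw [← Submonoid.coe_mul, mul_inv_cancel]; rfl
        simp only [Ad, LinearMap.comp_apply, LinearMap.coe_mk, AddHom.coe_mk, inv_inv,
          LinearMap.id_apply]
        rw [← Matrix.mul_assoc, ← Matrix.mul_assoc, h1, Matrix.one_mul, Matrix.mul_assoc, h1,
          Matrix.mul_one])
    have hc : ∀ μ, coAd R⁻¹ (coAd R μ) = μ := by
      intro μ
      refine LinearMap.ext fun ξ => ?_
      change μ (Ad R (Ad R⁻¹ ξ)) = μ ξ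
      rw [← LinearMap.comp_apply (Ad R), hm, LinearMap.id_apply]
    have hJ := hc (Jdual d)
    simp only [Set.mem_ofPred_eq] at h ⊢
    rwa [h] at hJ

/-- The momentum level set `M⁻¹(J)`, with the subspace topology. -/
abbrev LevelSet (d : ℕ) : Type := {Z : Phase d // momentum Z = Jdual d}

/-- Two points of `M⁻¹(J)` are equivalent if they lie in the same orbit of `O(2d)_J`. -/
def orbitSetoid (d : ℕ) : Setoid (LevelSet d) where
  r S S' := ∃ R ∈ isotropy d, (S' : Phase d) = (S : Phase d) * (R : Phase d)
  iseqv :=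
    { refl := fun S => ⟨1, one_mem _, by simp⟩
      symm := by
        rintro S S' ⟨R, hR, h⟩
        refine ⟨R⁻¹, inv_mem hR, ?_⟩
        have h1 : (R : Phase d) * ((R⁻¹ : O d) : Phase d) = 1 := by
          rw [← Submonoid.coe_mul, mul_inv_cancel]; rfl
        rw [h, Matrix.mul_assoc, h1, Matrix.mul_one]
      trans := by
        rintro S S' S'' ⟨R, hR, h⟩ ⟨R', hR', h'⟩
        exact ⟨R * R', mul_mem hR hR', by rw [h', h, Matrix.mul_assoc]; rfl⟩ }

/-- The Marsden--Weinstein quotient `M⁻¹(J) / O(2d)_J`, with the quotient topology. -/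
abbrev Reduced (d : ℕ) : Type := Quotient (orbitSetoid d)

/-- The projection `π_J : M⁻¹(J) → M⁻¹(J) / O(2d)_J`. -/
def piJ {d : ℕ} (S : LevelSet d) : Reduced d := Quotient.mk (orbitSetoid d) S

/-- The inclusion `i_J : M⁻¹(J) → Z_d`. -/
def iJ {d : ℕ} (S : LevelSet d) : Phase d := S

/-- The Lie algebra `sp(2d, ℝ) = {X | Xᵀ J + J X = 0}` as a vector space, of dimension `d(2d+1)`; it
serves as the model space of the manifold `M⁻¹(J)`. -/
def spLie (d : ℕ) : Submodule ℝ (Phase d) where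
  carrier := {X | Xᵀ * (J d : Phase d) + (J d : Phase d) * X = 0}
  add_mem' := by
    intro X Y hX hY
    simp only [Set.mem_ofPred_eq] at hX hY ⊢
    rw [transpose_add, Matrix.add_mul, Matrix.mul_add, add_add_add_comm, hX, hY, add_zero]
  zero_mem' := by simp
  smul_mem' := by
    intro c X hX
    simp only [Set.mem_ofPred_eq] at hX ⊢
    rw [transpose_smul, Matrix.smul_mul, Matrix.mul_smul, ← smul_add, hX, smul_zero]

/-- The subgroup `Sp(2d, ℝ) ∩ O(2d)` of `Sp(2d, ℝ)`. -/
def spOrthogonal (d : ℕ) : Subgroup (Matrix.symplecticGroup (Fin d) ℝ) where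
  carrier := {S | (S : Phase d) ∈ Matrix.orthogonalGroup (Fin d ⊕ Fin d) ℝ}
  one_mem' := one_mem (Matrix.orthogonalGroup (Fin d ⊕ Fin d) ℝ)
  mul_mem' := by
    intro S S' h h'
    exact Submonoid.mul_mem (Matrix.orthogonalGroup (Fin d ⊕ Fin d) ℝ) h h'
  inv_mem' := by
    intro S h
    have h1 : (S : Phase d) * ((S⁻¹ : Matrix.symplecticGroup (Fin d) ℝ) : Phase d) = 1 := by
      rw [← Submonoid.coe_mul, mul_inv_cancel]; rfl
    have h2 : star (S : Phase d) * (S : Phase d) = 1 := (Matrix.mem_unitaryGroup_iff').1 h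
    have h3 : ((S⁻¹ : Matrix.symplecticGroup (Fin d) ℝ) : Phase d) = star (S : Phase d) := by
      calc ((S⁻¹ : Matrix.symplecticGroup (Fin d) ℝ) : Phase d)
          = (star (S : Phase d) * (S : Phase d)) *
              ((S⁻¹ : Matrix.symplecticGroup (Fin d) ℝ) : Phase d) := by rw [h2, Matrix.one_mul]
        _ = star (S : Phase d) := by rw [Matrix.mul_assoc, h1, Matrix.mul_one]
    change ((S⁻¹ : Matrix.symplecticGroup (Fin d) ℝ) : Phase d) ∈
      Matrix.orthogonalGroup (Fin d ⊕ Fin d) ℝ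
    rw [h3]
    exact Unitary.star_mem h

/-! ### The Siegel upper half space -/

/-- The real vector space of complex symmetric `d × d` matrices. -/
def SymC (d : ℕ) : Submodule ℝ (Matrix (Fin d) (Fin d) ℂ) where
  carrier := {X | Xᵀ = X}
  add_mem' := by
    intro X Y hX hY
    simp only [Set.mem_ofPred_eq] at hX hY ⊢
    rw [transpose_add, hX, hY]
  zero_mem' := transpose_zero
  smul_mem' := by
    intro c X hX
    simp only [Set.mem_ofPred_eq] at hX ⊢
    rw [transpose_smul, hX]

/-- The imaginary part `ℬ` of `𝒳 = 𝒜 + iℬ`. -/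
def imPart {d : ℕ} (X : SymC d) : Matrix (Fin d) (Fin d) ℝ :=
  (X : Matrix (Fin d) (Fin d) ℂ).map Complex.im

/-- The Siegel upper half space `Σ_d` of complex symmetric matrices `𝒜 + iℬ` with `ℬ > 0`, as an open
subset of the space of complex symmetric matrices, from which it takes its manifold structure. -/
def Siegel (d : ℕ) : TopologicalSpace.Opens (SymC d) where
  carrier := {X | (imPart X).PosDef}
  is_open' := by
    have hc : Continuous fun p : SymC d × (Fin d → ℝ) => p.2 ⬝ᵥ (imPart p.1 *ᵥ p.2) := by
      have h1 : Continuous fun p : SymC d × (Fin d → ℝ) => imPart p.1 :=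
        (continuous_subtype_val.comp continuous_fst).matrix_map Complex.continuous_im
      exact continuous_snd.dotProduct (h1.matrix_mulVec continuous_snd)
    have hH : ∀ X : SymC d, (imPart X).IsHermitian := by
      intro X
      have hX : (X : Matrix (Fin d) (Fin d) ℂ)ᵀ = X := X.2
      rw [Matrix.IsHermitian, conjTranspose_eq_transpose_of_trivial, imPart, ← transpose_map, hX]
    have hP : ∀ X : SymC d, (imPart X).PosDef ↔
        ∀ v ∈ Metric.sphere (0 : Fin d → ℝ) 1, 0 < v ⬝ᵥ (imPart X *ᵥ v) := by
      intro X
      rw [posDef_iff_dotProduct_mulVec]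
      constructor
      · intro h v hv
        have hv0 : v ≠ 0 := by
          rintro rfl
          simp at hv
        simpa using h.2 hv0
      · intro h
        refine ⟨hH X, fun v hv => ?_⟩
        have hn : 0 < ‖v‖ := norm_pos_iff.2 hv
        have h1 := h (‖v‖⁻¹ • v) (by simp [norm_smul, hn.ne'])
        rw [mulVec_smul, smul_dotProduct, dotProduct_smul, smul_eq_mul, smul_eq_mul] at h1
        have h2 := pos_of_mul_pos_right h1 (by positivity)
        simpa using pos_of_mul_pos_right h2 (by positivity)
    rw [isOpen_iff_mem_nhds]
    intro X hX
    have hev : ∀ᶠ Y in nhds X, ∀ v ∈ Metric.sphere (0 : Fin d → ℝ) 1,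
        0 < v ⬝ᵥ (imPart Y *ᵥ v) := by
      refine (isCompact_sphere (0 : Fin d → ℝ) 1).eventually_forall_of_forall_eventually ?_
      intro v hv
      exact hc.continuousAt.eventually (lt_mem_nhds ((hP X).1 hX v hv))
    filter_upwards [hev] with Y hY
    exact (hP Y).2 hY

/-- The Hermitian metric `g = tr (ℬ⁻¹ d𝒞 ℬ⁻¹ d𝒞̄)` at `𝒳 = 𝒜 + iℬ`. -/
def siegelMetric {d : ℕ} (X V W : SymC d) : ℂ :=
  ((imPart X)⁻¹.map Complex.ofReal * (V : Matrix (Fin d) (Fin d) ℂ) *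
    (imPart X)⁻¹.map Complex.ofReal * (W : Matrix (Fin d) (Fin d) ℂ).map (starRingEnd ℂ)).trace

/-- The two-form `Ω_Σ = Im g`, that is, `-∑ d(ℬ⁻¹)_{jk} ∧ d𝒜_{jk}`. -/
def OmegaSiegel {d : ℕ} (X : SymC d) : SymC d [⋀^Fin 2]→L[ℝ] ℝ :=
  twoForm
    (LinearMap.mk₂ ℝ (fun V W : SymC d => (siegelMetric X V W).im)
      (by
        intro V V' W
        simp [siegelMetric, Matrix.add_mul, Matrix.mul_add])
      (by
        intro c V W
        simp [siegelMetric])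
      (by
        intro V W W'
        have h : ((W + W' : SymC d) : Matrix (Fin d) (Fin d) ℂ).map (starRingEnd ℂ) =
            (W : Matrix (Fin d) (Fin d) ℂ).map (starRingEnd ℂ) +
              (W' : Matrix (Fin d) (Fin d) ℂ).map (starRingEnd ℂ) := by
          ext i j
          simp
        simp only [siegelMetric, h, Matrix.mul_add, trace_add, Complex.add_im])
      (by
        intro c V W
        have h : ((c • W : SymC d) : Matrix (Fin d) (Fin d) ℂ).map (starRingEnd ℂ) =
            c • (W : Matrix (Fin d) (Fin d) ℂ).map (starRingEnd ℂ) := by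
          ext i j
          simp
        simp only [siegelMetric, h, Matrix.mul_smul, trace_smul, Complex.smul_im]))
    (by
      intro V
      change (siegelMetric X V V).im = 0
      rw [← Complex.conj_eq_iff_im]
      have hB : ((imPart X)⁻¹.map Complex.ofReal).map (starRingEnd ℂ) =
          (imPart X)⁻¹.map Complex.ofReal := by
        ext i j
        simp
      have hV : ((V : Matrix (Fin d) (Fin d) ℂ).map (starRingEnd ℂ)).map (starRingEnd ℂ) = V := by
        ext i j
        simp
      have h : (starRingEnd ℂ) (siegelMetric X V V) =
          ((imPart X)⁻¹.map Complex.ofReal * (V : Matrix (Fin d) (Fin d) ℂ).map (starRingEnd ℂ) *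
            (imPart X)⁻¹.map Complex.ofReal * (V : Matrix (Fin d) (Fin d) ℂ)).trace := by
        rw [siegelMetric, AddMonoidHom.map_trace, Matrix.map_mul, Matrix.map_mul, Matrix.map_mul,
          hB, hV]
      rw [h, siegelMetric, Matrix.mul_assoc, Matrix.trace_mul_comm]
      simp only [Matrix.mul_assoc])

/-- The matrix `A + B𝒳` for `S = [A B; C D]`. -/
def denom {d : ℕ} (S : Phase d) (X : Matrix (Fin d) (Fin d) ℂ) : Matrix (Fin d) (Fin d) ℂ :=
  S.toBlocks₁₁.map Complex.ofReal + S.toBlocks₁₂.map Complex.ofReal * X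

/-- The generalized linear fractional transformation `Ψ_S(𝒳) = (C + D𝒳)(A + B𝒳)⁻¹` of
`S = [A B; C D]`. -/
def moebius {d : ℕ} (S : Phase d) (X : Matrix (Fin d) (Fin d) ℂ) : Matrix (Fin d) (Fin d) ℂ :=
  (S.toBlocks₂₁.map Complex.ofReal + S.toBlocks₂₂.map Complex.ofReal * X) * (denom S X)⁻¹

/-- The point `i I_d` of the Siegel upper half space. -/
def iI (d : ℕ) : Matrix (Fin d) (Fin d) ℂ := Complex.I • 1

end

end SiegelReduction

open Matrix
open scoped Manifold ContDiff Matrix.Norms.L2Operator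

namespace SiegelReduction

noncomputable section

variable {d : ℕ}

/-! ### The momentum map -/

/-! Every form involved is a trace against a fixed matrix. With `E = thetaMatrix d` one has `Θ_Z(X)
= tr(Zᵀ E X)`, and `J = Eᵀ - E`, so `Ω(X, Y) = tr(Xᵀ J Y)` and, through `toDual`, the momentum map
is `Z ↦ Zᵀ J Z` (`momentum_eq_toDual`). Hence the level set of `J` is the symplectic group. Since
`M(1) = J`, equivariance gives `Ad_R^* J = M(R)`, so the isotropy group is `Sp ∩ O`: the orthogonal
matrices commuting with the complex structure `J`, that is, the unitary ones.

The quotient is identified by letting `S` act on the `2d × d` matrix `[I; iI]`, whose columns span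
the `i`-eigenspace of `J`. The image is `[den; num]` with `den = A + iB` and `num = C + iD`. That
`S` preserves the complex bilinear form of `J` makes `num den⁻¹` symmetric; that it preserves the
sesquilinear one gives `denᴴ num - numᴴ den = 2i`, hence `den` is invertible and the imaginary part
is `(den denᴴ)⁻¹ > 0`. Two symplectic matrices give the same point exactly when `S⁻¹ S'` preserves
the eigenspace, i.e. lies in the isotropy group (`toSymC_eq_iff`); every point is attained by
factoring its imaginary part (`exists_toSymC_eq`).

In the direction `S X`, `X ∈ sp(2d, ℝ)`, the orbit map has derivative `den⁻ᵀ w den⁻¹`, where `w` is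
the symmetric form `J X` evaluated on `[I; iI]`. The factors `den` cancel in the Siegel metric,
leaving `Im tr(w w̄') = -2 tr(Xᵀ J Y)` (`OmegaSiegel_tangentMap`), while `Ω(S X, S Y) = tr(Xᵀ J Y)`;
this is the constant `-1/2`. The derivative is onto, so the orbit map is open and identifies the
quotient with an open set of symmetric matrices, which supplies its only chart, and a two-form on
the quotient is determined by its pull-back. The level set is a manifold through Cayley transforms.
-/

/-- The matrix of the bilinear form `(Z, X) ↦ Θ_Z(X)`. -/
def thetaMatrix (d : ℕ) : Phase d := fromBlocks 0 0 1 0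

lemma coe_J : (J d : Phase d) = fromBlocks 0 1 (-1) 0 := rfl

lemma coe_J_eq_sub : (J d : Phase d) = (thetaMatrix d)ᵀ - thetaMatrix d := by
  rw [coe_J, thetaMatrix, fromBlocks_transpose, sub_eq_add_neg, fromBlocks_neg, fromBlocks_add]
  simp

lemma J_transpose : (J d : Phase d)ᵀ = -(J d : Phase d) := by
  rw [coe_J_eq_sub]; simp

lemma J_mul_J : (J d : Phase d) * (J d : Phase d) = -1 := by
  rw [coe_J, fromBlocks_multiply, ← fromBlocks_one, fromBlocks_neg]
  simp

/-- With a single trace in place of the block pairings, invariance under right multiplication by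
orthogonal matrices becomes cyclicity of the trace. -/
lemma Theta_eq_trace (Z X : Phase d) : Theta Z X = (Zᵀ * thetaMatrix d * X).trace := by
  change (Z.toBlocks₂₁ᵀ * X.toBlocks₁₁).trace + (Z.toBlocks₂₂ᵀ * X.toBlocks₁₂).trace = _
  conv_rhs => rw [← fromBlocks_toBlocks Z, ← fromBlocks_toBlocks X]
  rw [thetaMatrix, fromBlocks_transpose, fromBlocks_multiply, fromBlocks_multiply,
    Matrix.trace, Matrix.trace, Matrix.trace, Fintype.sum_sum_type]
  simp

lemma OmegaZ_eq_trace (X Y : Phase d) :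
    OmegaZ d ![X, Y] = (Xᵀ * (J d : Phase d) * Y).trace := by
  change ∑ j, ∑ k,
          ((X.toBlocks₁₁ j k * Y.toBlocks₂₁ j k - Y.toBlocks₁₁ j k * X.toBlocks₂₁ j k) +
            (X.toBlocks₁₂ j k * Y.toBlocks₂₂ j k - Y.toBlocks₁₂ j k * X.toBlocks₂₂ j k)) = _
  conv_rhs => rw [← fromBlocks_toBlocks X, ← fromBlocks_toBlocks Y]
  rw [coe_J, fromBlocks_transpose, fromBlocks_multiply, fromBlocks_multiply, Matrix.trace,
    Fintype.sum_sum_type]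
  simp only [diag, fromBlocks_apply₁₁, fromBlocks_apply₂₂, mul_apply, Matrix.add_apply, transpose_apply, Matrix.mul_zero,
    Matrix.mul_one, Matrix.mul_neg, zero_add, add_zero, Matrix.neg_apply, ← Finset.sum_add_distrib]
  rw [Finset.sum_comm]
  refine Finset.sum_congr rfl fun j _ => Finset.sum_congr rfl fun k _ => ?_
  ring

lemma OmegaZ_apply (v : Fin 2 → Phase d) :
    OmegaZ d v = ((v 0)ᵀ * (J d : Phase d) * v 1).trace := by
  rw [← OmegaZ_eq_trace]
  congr 1
  ext i : 1
  fin_cases i <;> rfl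

/-- This is `J = Eᵀ - E` under the trace. As `Θ` is linear in the base point, the right side is
`-dΘ` on constant vector fields. -/
lemma OmegaZ_eq_Theta_sub (X Y : Phase d) : OmegaZ d ![X, Y] = Theta Y X - Theta X Y := by
  rw [OmegaZ_eq_trace, Theta_eq_trace, Theta_eq_trace, coe_J_eq_sub, Matrix.mul_sub,
    Matrix.sub_mul, trace_sub]
  congr 1
  rw [← trace_transpose]
  simp [Matrix.mul_assoc]

lemma Theta_add_left (Z Z' X : Phase d) : Theta (Z + Z') X = Theta Z X + Theta Z' X := by
  simp [Theta_eq_trace, Matrix.add_mul]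

lemma Theta_smul_left (c : ℝ) (Z X : Phase d) : Theta (c • Z) X = c * Theta Z X := by
  simp [Theta_eq_trace]

/-- `Z ↦ Θ_Z` as a continuous linear map. -/
def ThetaCLM (d : ℕ) : Phase d →L[ℝ] Phase d →L[ℝ] ℝ :=
  LinearMap.toContinuousLinearMap
    { toFun := Theta
      map_add' := fun Z Z' => ContinuousLinearMap.ext (Theta_add_left Z Z')
      map_smul' := fun c Z => ContinuousLinearMap.ext (Theta_smul_left c Z) }

lemma extDeriv_Theta (Z : Phase d) :
    extDeriv (fun Z' : Phase d =>
      ContinuousAlternatingMap.ofSubsingleton ℝ (Phase d) ℝ (0 : Fin 1) (Theta Z')) Z =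
        -OmegaZ d := by
  have hc : (fun Z' : Phase d =>
      ContinuousAlternatingMap.ofSubsingleton ℝ (Phase d) ℝ (0 : Fin 1) (Theta Z')) =
      fun Z' => ContinuousAlternatingMap.ofSubsingletonLIE (𝕜 := ℝ) (E := Phase d) (F := ℝ) (0 : Fin 1)
        (ThetaCLM d Z') := rfl
  have hd : DifferentiableAt ℝ (fun Z' : Phase d =>
      ContinuousAlternatingMap.ofSubsingleton ℝ (Phase d) ℝ (0 : Fin 1) (Theta Z')) Z := by
    rw [hc]; fun_prop
  have hf : ∀ X W : Phase d, fderiv ℝ (fun Z' : Phase d => Theta Z' X) Z W = Theta W X := by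
    intro X W
    exact congrArg (fun f => f W) ((ThetaCLM d).flip X).fderiv
  ext v
  rw [extDeriv_apply hd]
  have hv : OmegaZ d v = OmegaZ d ![v 0, v 1] := by
    congr 1
    ext i : 1
    fin_cases i <;> rfl
  simp [Fin.sum_univ_two, hf, Fin.removeNth, hv, OmegaZ_eq_Theta_sub, sub_eq_add_neg]

lemma orthogonal_mul_transpose (R : O d) : (R : Phase d) * (R : Phase d)ᵀ = 1 :=
  (mem_unitaryGroup_iff (A := (R : Phase d))).1 R.2

lemma orthogonal_transpose_mul (R : O d) : (R : Phase d)ᵀ * (R : Phase d) = 1 :=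
  (mem_unitaryGroup_iff' (A := (R : Phase d))).1 R.2

lemma Theta_mul_orthogonal (R : O d) (Z X : Phase d) :
    Theta (Z * (R : Phase d)) (X * (R : Phase d)) = Theta Z X := by
  simp only [Theta_eq_trace, transpose_mul]
  rw [show (R : Phase d)ᵀ * Zᵀ * thetaMatrix d * (X * (R : Phase d)) =
    (R : Phase d)ᵀ * (Zᵀ * thetaMatrix d * X * (R : Phase d)) by simp only [Matrix.mul_assoc],
    trace_mul_comm, Matrix.mul_assoc, orthogonal_mul_transpose, Matrix.mul_one]

lemma OmegaZ_mul_orthogonal (R : O d) (X Y : Phase d) :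
    OmegaZ d ![X * (R : Phase d), Y * (R : Phase d)] = OmegaZ d ![X, Y] := by
  simp only [OmegaZ_eq_Theta_sub, Theta_mul_orthogonal]

lemma so_transpose (ξ : o d) : (ξ : Phase d)ᵀ = -(ξ : Phase d) :=
  (LieAlgebra.Orthogonal.mem_so _ _ _).1 ξ.2

lemma eq_zero_of_trace_transpose_mul_self {n : Type*} [Fintype n] {A : Matrix n n ℝ}
    (h : (Aᵀ * A).trace = 0) : A = 0 := by
  rw [← conjTranspose_eq_transpose_of_trivial] at h
  exact trace_conjTranspose_mul_self_eq_zero_iff.1 h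

lemma isSymplecticOn_OmegaZ : IsSymplecticOn (fun _ : Phase d => OmegaZ d) Set.univ := by
  refine ⟨contDiffOn_const, fun Z _ => ?_, fun Z _ X hX => ?_⟩
  · ext v
    rw [extDeriv_apply (differentiableAt_const _)]
    simp
  · apply eq_zero_of_trace_transpose_mul_self
    -- Since `J² = -1`, pairing `X` with `-J X` yields `tr(Xᵀ X)`.
    have h := hX (-((J d : Phase d) * X))
    rw [OmegaZ_eq_trace] at h
    rw [← h, Matrix.mul_neg, ← Matrix.mul_assoc, Matrix.mul_assoc Xᵀ, J_mul_J]
    simp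

lemma hasDerivAt_mul_exp (ξ : o d) (Z : Phase d) :
    HasDerivAt (fun ε : ℝ => Z * NormedSpace.exp (ε • (ξ : Phase d))) (generator ξ Z) 0 := by
  have h := (hasDerivAt_exp_smul_const (𝕂 := ℝ) (ξ : Phase d) 0).const_mul Z
  simpa [generator] using h

lemma momentum_apply (Z : Phase d) (ξ : o d) : momentum Z ξ = Theta Z (Z * (ξ : Phase d)) := rfl

lemma Theta_mul_so (Z X : Phase d) (ξ : o d) :
    (Theta Z (X * (ξ : Phase d))) = -(Xᵀ * (thetaMatrix d)ᵀ * Z * (ξ : Phase d)).trace := by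
  rw [Theta_eq_trace, ← trace_transpose]
  simp only [transpose_mul, so_transpose, transpose_transpose, Matrix.neg_mul, trace_neg]
  rw [Matrix.mul_assoc, trace_mul_comm]
  simp only [Matrix.mul_assoc]

lemma hasFDerivAt_momentum (ξ : o d) (Z : Phase d) :
    HasFDerivAt (fun Z' : Phase d => momentum Z' ξ)
      ((Theta Z).comp ((ContinuousLinearMap.mul ℝ (Phase d)).flip (ξ : Phase d)) +
        (ThetaCLM d).flip (Z * (ξ : Phase d))) Z := by
  have h1 : HasFDerivAt (fun Z' : Phase d => ThetaCLM d Z') (ThetaCLM d) Z :=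
    (ThetaCLM d).hasFDerivAt
  have h2 : HasFDerivAt (fun Z' : Phase d => Z' * (ξ : Phase d))
      ((ContinuousLinearMap.mul ℝ (Phase d)).flip (ξ : Phase d)) Z :=
    ((ContinuousLinearMap.mul ℝ (Phase d)).flip (ξ : Phase d)).hasFDerivAt
  exact h1.clm_apply h2

lemma fderiv_momentum (ξ : o d) (Z X : Phase d) :
    fderiv ℝ (fun Z' : Phase d => momentum Z' ξ) Z X =
      Theta Z (X * (ξ : Phase d)) + Theta X (Z * (ξ : Phase d)) := by
  rw [(hasFDerivAt_momentum ξ Z).fderiv]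
  rfl

/-- The product rule gives `Θ_Z(X ξ) + Θ_X(Z ξ)`; skewness of `ξ`, the infinitesimal invariance of
`Θ`, turns the first term into `-Θ_{Zξ}(X)`. -/
lemma fderiv_momentum_eq_OmegaZ (ξ : o d) (Z X : Phase d) :
    fderiv ℝ (fun Z' : Phase d => momentum Z' ξ) Z X = OmegaZ d ![generator ξ Z, X] := by
  rw [fderiv_momentum, OmegaZ_eq_Theta_sub, generator, add_comm, sub_eq_add_neg]
  congr 1
  rw [Theta_eq_trace, Theta_eq_trace, transpose_mul, so_transpose, ← Matrix.mul_assoc,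
    trace_mul_comm]
  simp [Matrix.mul_assoc]

lemma momentum_mul_orthogonal (R : O d) (Z : Phase d) :
    momentum (Z * (R : Phase d)) = coAd R (momentum Z) := by
  refine LinearMap.ext fun ξ => ?_
  change Theta (Z * (R : Phase d)) (Z * (R : Phase d) * (ξ : Phase d)) =
    Theta Z (Z * ((R : Phase d) * (ξ : Phase d) * (R : Phase d)ᵀ))
  rw [← Theta_mul_orthogonal R Z]
  simp only [Matrix.mul_assoc, orthogonal_transpose_mul, Matrix.mul_one]

lemma toDual_apply (ξ η : o d) :
    toDual ξ η = (1 / 2 : ℝ) * ((ξ : Phase d)ᵀ * (η : Phase d)).trace := rfl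

lemma toDual_injective : Function.Injective (toDual (d := d)) := by
  rw [injective_iff_map_eq_zero]
  intro ξ h
  have h1 := LinearMap.congr_fun h ξ
  rw [toDual_apply, LinearMap.zero_apply] at h1
  exact Subtype.ext (eq_zero_of_trace_transpose_mul_self (by linarith))

lemma toDual_bijective : Function.Bijective (toDual (d := d)) :=
  ⟨toDual_injective, (LinearMap.injective_iff_surjective_of_finrank_eq_finrank
    (Subspace.dual_finrank_eq (K := ℝ) (V := o d)).symm).1 toDual_injective⟩

lemma transpose_J_mul_mem_so (Z : Phase d) :
    Zᵀ * (J d : Phase d) * Z ∈ LieAlgebra.Orthogonal.so (Fin d ⊕ Fin d) ℝ := by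
  rw [LieAlgebra.Orthogonal.mem_so]
  simp [J_transpose, Matrix.mul_assoc]

/-- Only the skew part `-½ Zᵀ J Z` of `Zᵀ E Z` pairs nontrivially with the skew `ξ`. Its sign is
absorbed by the transpose in `toDual` and its factor by the `½` there. -/
lemma momentum_eq_toDual (Z : Phase d) :
    momentum Z = toDual ⟨Zᵀ * (J d : Phase d) * Z, transpose_J_mul_mem_so Z⟩ := by
  refine LinearMap.ext fun ξ => ?_
  have h1 := Theta_mul_so Z Z ξ
  have h2 := Theta_eq_trace Z (Z * (ξ : Phase d))
  rw [momentum_apply, toDual_apply]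
  simp only [transpose_mul, transpose_transpose, coe_J_eq_sub, transpose_sub]
  simp only [Matrix.sub_mul, Matrix.mul_sub, trace_sub]
  simp only [Matrix.mul_assoc] at h1 h2 ⊢
  linarith

lemma momentum_fromBlocks (Q₁ Q₂ P₁ P₂ : Matrix (Fin d) (Fin d) ℝ) :
    ∃ h : fromBlocks (Q₁ᵀ * P₁ - P₁ᵀ * Q₁) (Q₁ᵀ * P₂ - P₁ᵀ * Q₂)
        (-(Q₁ᵀ * P₂ - P₁ᵀ * Q₂)ᵀ) (Q₂ᵀ * P₂ - P₂ᵀ * Q₂) ∈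
          LieAlgebra.Orthogonal.so (Fin d ⊕ Fin d) ℝ,
      momentum (fromBlocks Q₁ Q₂ P₁ P₂) = toDual ⟨_, h⟩ := by
  have h : fromBlocks (Q₁ᵀ * P₁ - P₁ᵀ * Q₁) (Q₁ᵀ * P₂ - P₁ᵀ * Q₂)
        (-(Q₁ᵀ * P₂ - P₁ᵀ * Q₂)ᵀ) (Q₂ᵀ * P₂ - P₂ᵀ * Q₂) =
      (fromBlocks Q₁ Q₂ P₁ P₂)ᵀ * (J d : Phase d) * fromBlocks Q₁ Q₂ P₁ P₂ := by
    rw [coe_J, fromBlocks_transpose, fromBlocks_multiply, fromBlocks_multiply, fromBlocks_inj]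
    simp only [transpose_sub, transpose_mul, transpose_transpose, Matrix.mul_zero, Matrix.mul_one,
      Matrix.mul_neg, zero_add, add_zero, Matrix.neg_mul]
    refine ⟨?_, ?_, ?_, ?_⟩ <;> abel
  refine ⟨h ▸ transpose_J_mul_mem_so _, ?_⟩
  rw [momentum_eq_toDual]
  exact congrArg toDual (Subtype.ext h.symm)

lemma momentum_eq_Jdual_iff {Z : Phase d} :
    momentum Z = Jdual d ↔ Zᵀ * (J d : Phase d) * Z = (J d : Phase d) := by
  rw [momentum_eq_toDual, Jdual, toDual_injective.eq_iff, Subtype.ext_iff]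

lemma coe_J_eq_neg : (J d : Phase d) = -Matrix.J (Fin d) ℝ := by
  rw [coe_J, Matrix.J, fromBlocks_neg]
  simp

lemma mem_symplecticGroup_iff {Z : Phase d} :
    Z ∈ symplecticGroup (Fin d) ℝ ↔ Zᵀ * (J d : Phase d) * Z = (J d : Phase d) := by
  rw [SymplecticGroup.mem_iff', coe_J_eq_neg]
  simp

lemma levelSet_eq :
    {Z : Phase d | momentum Z = Jdual d} = (symplecticGroup (Fin d) ℝ : Set (Phase d)) := by
  ext Z
  exact momentum_eq_Jdual_iff.trans mem_symplecticGroup_iff.symm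

lemma LevelSet.transpose_J_mul (S : LevelSet d) :
    (S : Phase d)ᵀ * (J d : Phase d) * (S : Phase d) = (J d : Phase d) :=
  momentum_eq_Jdual_iff.1 S.2

lemma LevelSet.mem_symplecticGroup (S : LevelSet d) :
    (S : Phase d) ∈ symplecticGroup (Fin d) ℝ :=
  mem_symplecticGroup_iff.2 S.transpose_J_mul

lemma LevelSet.isUnit (S : LevelSet d) : IsUnit (S : Phase d) :=
  (isUnit_iff_isUnit_det _).2 (SymplecticGroup.symplectic_det S.mem_symplecticGroup)

lemma momentum_regular (S : LevelSet d) (μ : Module.Dual ℝ (o d)) :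
    ∃ X : Phase d, ∀ ξ : o d,
      fderiv ℝ (fun Z : Phase d => momentum Z ξ) (S : Phase d) X = μ ξ := by
  obtain ⟨η, rfl⟩ := toDual_bijective.2 μ
  have hη := so_transpose η
  -- The witness `-½ S J η` solves `Sᵀ J X = ½ η`, because `Sᵀ J S = J` and `J² = -1`; the
  -- derivative along it is then `-½ tr(ξ η) = ½ tr(ηᵀ ξ)`.
  have key : (S : Phase d)ᵀ * (J d : Phase d) *
      (-(1 / 2 : ℝ) • ((S : Phase d) * (J d : Phase d) * (η : Phase d))) =
        (1 / 2 : ℝ) • (η : Phase d) := by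
    rw [Matrix.mul_smul, ← Matrix.mul_assoc, ← Matrix.mul_assoc, S.transpose_J_mul, J_mul_J]
    simp
  generalize -(1 / 2 : ℝ) • ((S : Phase d) * (J d : Phase d) * (η : Phase d)) = X at key
  refine ⟨X, fun ξ => ?_⟩
  rw [fderiv_momentum_eq_OmegaZ, OmegaZ_eq_trace, generator, transpose_mul, so_transpose,
    toDual_apply, hη, Matrix.mul_assoc, Matrix.mul_assoc, ← Matrix.mul_assoc _ _ X, key]
  rw [Matrix.mul_smul, trace_smul, smul_eq_mul, Matrix.neg_mul, Matrix.neg_mul, trace_neg,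
    trace_neg, trace_mul_comm]

/-! ### The isotropy group -/

/-- The identity matrix lies in the level set, so equivariance at `1` reads `Ad_R^* J = M(R)`. -/
lemma mem_isotropy_iff_transpose {R : O d} :
    R ∈ isotropy d ↔ (R : Phase d)ᵀ * (J d : Phase d) * (R : Phase d) = (J d : Phase d) := by
  have h1 : momentum (1 : Phase d) = Jdual d := momentum_eq_Jdual_iff.2 (by simp)
  have h2 := momentum_mul_orthogonal R 1
  rw [h1, Matrix.one_mul] at h2
  change coAd R (Jdual d) = Jdual d ↔ _
  rw [← h2, momentum_eq_Jdual_iff]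

lemma mem_isotropy_iff {R : O d} :
    R ∈ isotropy d ↔ (R : Phase d) ∈ symplecticGroup (Fin d) ℝ :=
  mem_isotropy_iff_transpose.trans mem_symplecticGroup_iff.symm

lemma commute_J_of_mem_isotropy {R : O d} (hR : R ∈ isotropy d) :
    (R : Phase d) * (J d : Phase d) = (J d : Phase d) * (R : Phase d) := by
  conv_lhs => rw [← mem_isotropy_iff_transpose.1 hR]
  rw [← Matrix.mul_assoc, ← Matrix.mul_assoc, orthogonal_mul_transpose, Matrix.one_mul]

/-- The real matrix `[Re U, Im U; -Im U, Re U]` of a complex matrix `U`. -/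
def realify (U : Matrix (Fin d) (Fin d) ℂ) : Phase d :=
  fromBlocks (U.map Complex.re) (U.map Complex.im) (-(U.map Complex.im)) (U.map Complex.re)

/-- The complex matrix `A + iB` of a real block matrix `[A B; C D]`. -/
def complexify (Z : Phase d) : Matrix (Fin d) (Fin d) ℂ :=
  Z.toBlocks₁₁.map Complex.ofReal + Complex.I • Z.toBlocks₁₂.map Complex.ofReal

lemma complexify_realify (U : Matrix (Fin d) (Fin d) ℂ) : complexify (realify U) = U := by
  ext i j
  simp [complexify, realify, mul_comm Complex.I, Complex.re_add_im]

lemma realify_injective : Function.Injective (realify (d := d)) :=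
  Function.LeftInverse.injective complexify_realify

/-- Comparing the blocks of `Z J` and `J Z` forces the shape `[U V; -V U]`. -/
lemma realify_complexify_of_commute {Z : Phase d}
    (h : Z * (J d : Phase d) = (J d : Phase d) * Z) : realify (complexify Z) = Z := by
  rw [← fromBlocks_toBlocks Z, coe_J, fromBlocks_multiply, fromBlocks_multiply,
    fromBlocks_inj] at h
  simp only [Matrix.mul_zero, Matrix.mul_neg, Matrix.mul_one, zero_add, Matrix.zero_mul,
    Matrix.one_mul, add_zero, Matrix.neg_mul] at h
  have hre : (complexify Z).map Complex.re = Z.toBlocks₁₁ := by ext; simp [complexify]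
  have him : (complexify Z).map Complex.im = Z.toBlocks₁₂ := by ext; simp [complexify]
  conv_rhs => rw [← fromBlocks_toBlocks Z]
  rw [realify, hre, him, ← h.2.1, h.1]

lemma realify_mul_J (U : Matrix (Fin d) (Fin d) ℂ) :
    realify U * (J d : Phase d) = (J d : Phase d) * realify U := by
  simp [coe_J, realify, fromBlocks_multiply]

lemma map_re_mul (U V : Matrix (Fin d) (Fin d) ℂ) :
    (U * V).map Complex.re =
      U.map Complex.re * V.map Complex.re - U.map Complex.im * V.map Complex.im := by
  ext i j; simp [mul_apply, Finset.sum_sub_distrib]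

lemma map_im_mul (U V : Matrix (Fin d) (Fin d) ℂ) :
    (U * V).map Complex.im =
      U.map Complex.re * V.map Complex.im + U.map Complex.im * V.map Complex.re := by
  ext i j; simp [mul_apply, Finset.sum_add_distrib]

lemma realify_mul (U V : Matrix (Fin d) (Fin d) ℂ) :
    realify (U * V) = realify U * realify V := by
  simp only [realify, fromBlocks_multiply, map_re_mul, map_im_mul, Matrix.neg_mul, Matrix.mul_neg]
  congr 1 <;> abel

lemma realify_one : realify (1 : Matrix (Fin d) (Fin d) ℂ) = 1 := by
  rw [← fromBlocks_one, realify, fromBlocks_inj]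
  refine ⟨?_, ?_, ?_, ?_⟩ <;> ext i j <;> by_cases h : i = j <;> simp [h, one_apply]

lemma realify_conjTranspose (U : Matrix (Fin d) (Fin d) ℂ) : realify Uᴴ = (realify U)ᵀ := by
  rw [realify, realify, fromBlocks_transpose, fromBlocks_inj]
  refine ⟨?_, ?_, ?_, ?_⟩ <;> ext i j <;> simp

/-- `realify` is injective, multiplicative and unital, and takes adjoints to transposes. -/
lemma mem_unitaryGroup_iff_realify {U : Matrix (Fin d) (Fin d) ℂ} :
    U ∈ unitaryGroup (Fin d) ℂ ↔ realify U ∈ orthogonalGroup (Fin d ⊕ Fin d) ℝ := by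
  rw [mem_unitaryGroup_iff, mem_orthogonalGroup_iff, ← realify_injective.eq_iff, realify_mul,
    realify_one, star_eq_conjTranspose, realify_conjTranspose]

lemma continuous_realify : Continuous (realify (d := d)) := by
  unfold realify
  have h1 : Continuous fun U : Matrix (Fin d) (Fin d) ℂ => U.map Complex.re :=
    continuous_id.matrix_map Complex.continuous_re
  have h2 : Continuous fun U : Matrix (Fin d) (Fin d) ℂ => U.map Complex.im :=
    continuous_id.matrix_map Complex.continuous_im
  exact h1.matrix_fromBlocks h2 h2.neg h1

lemma continuous_complexify : Continuous (complexify (d := d)) := by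
  have h1 : Continuous fun Z : Phase d => Z.toBlocks₁₁ :=
    continuous_id.matrix_submatrix Sum.inl Sum.inl
  have h2 : Continuous fun Z : Phase d => Z.toBlocks₁₂ :=
    continuous_id.matrix_submatrix Sum.inl Sum.inr
  have h3 : Continuous fun Z : Phase d => Complex.I • Z.toBlocks₁₂.map Complex.ofReal :=
    (h2.matrix_map Complex.continuous_ofReal).const_smul Complex.I
  exact (h1.matrix_map Complex.continuous_ofReal).add h3

lemma mem_isotropy_of_commute_J (R : O d)
    (h : (R : Phase d) * (J d : Phase d) = (J d : Phase d) * (R : Phase d)) :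
    R ∈ isotropy d := by
  rw [mem_isotropy_iff_transpose, Matrix.mul_assoc, ← h, ← Matrix.mul_assoc,
    orthogonal_transpose_mul, Matrix.one_mul]

/-- The isomorphism `[U V; -V U] ↦ U + iV` of the isotropy group of `J` onto `U(d)`. -/
def isotropyEquiv (d : ℕ) : isotropy d ≃ₜ* unitaryGroup (Fin d) ℂ where
  toFun R := ⟨complexify ((R : O d) : Phase d), by
    rw [mem_unitaryGroup_iff_realify,
      realify_complexify_of_commute (commute_J_of_mem_isotropy R.2)]
    exact R.1.2⟩
  invFun U := ⟨⟨realify (U : Matrix (Fin d) (Fin d) ℂ), mem_unitaryGroup_iff_realify.1 U.2⟩,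
    mem_isotropy_of_commute_J _ (realify_mul_J _)⟩
  left_inv R := Subtype.ext (Subtype.ext
    (realify_complexify_of_commute (commute_J_of_mem_isotropy R.2)))
  right_inv U := Subtype.ext (complexify_realify _)
  map_mul' R R' := by
    refine Subtype.ext (realify_injective ?_)
    change realify (complexify (((R * R' : isotropy d) : O d) : Phase d)) =
      realify (complexify ((R : O d) : Phase d) * complexify ((R' : O d) : Phase d))
    rw [realify_mul, realify_complexify_of_commute (commute_J_of_mem_isotropy R.2),
      realify_complexify_of_commute (commute_J_of_mem_isotropy R'.2),
      realify_complexify_of_commute (commute_J_of_mem_isotropy (R * R').2)]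
    rfl
  continuous_toFun := (continuous_complexify.comp
    (continuous_subtype_val.comp continuous_subtype_val)).subtype_mk _
  continuous_invFun :=
    ((continuous_realify.comp continuous_subtype_val).subtype_mk _).subtype_mk _

lemma compactSpace_isotropy (d : ℕ) : CompactSpace (isotropy d) := by
  have hi : Topology.IsInducing fun R : isotropy d => ((R : O d) : Phase d) :=
    Topology.IsInducing.subtypeVal.comp Topology.IsInducing.subtypeVal
  have hr : Set.range (fun R : isotropy d => ((R : O d) : Phase d)) =
      {Z : Phase d | Z * Zᵀ = 1} ∩ {Z : Phase d | Zᵀ * (J d : Phase d) * Z = (J d : Phase d)} := by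
    ext Z
    constructor
    · rintro ⟨R, rfl⟩
      exact ⟨orthogonal_mul_transpose _, mem_isotropy_iff_transpose.1 R.2⟩
    · rintro ⟨h1, h2⟩
      exact ⟨⟨⟨Z, mem_unitaryGroup_iff.2 h1⟩, mem_isotropy_iff_transpose.2 h2⟩, rfl⟩
  rw [← isCompact_univ_iff, hi.isCompact_iff, Set.image_univ, hr]
  refine Metric.isCompact_of_isClosed_isBounded (IsClosed.inter ?_ ?_) ?_
  · exact isClosed_eq (by fun_prop) continuous_const
  · exact isClosed_eq (by fun_prop) continuous_const
  -- The C*-identity gives `‖Z‖² = ‖1‖`, and `t ≤ 1 + t²`. Keeping `‖1‖` unevaluated includes `d =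
  -- 0`, where it vanishes.
  · refine (Metric.isBounded_closedBall (x := (0 : Phase d))
      (r := 1 + ‖(1 : Phase d)‖)).subset ?_
    rintro Z ⟨h1, -⟩
    have h2 : Zᴴ * Z = 1 := by
      rw [conjTranspose_eq_transpose_of_trivial]
      exact mul_eq_one_comm.1 h1
    have h3 := l2_opNorm_conjTranspose_mul_self Z
    rw [h2] at h3
    rw [mem_closedBall_zero_iff]
    nlinarith [norm_nonneg Z]

lemma isotropy_free (S : LevelSet d) (R : O d)
    (h : (S : Phase d) * (R : Phase d) = (S : Phase d)) : R = 1 := by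
  refine Subtype.ext (S.isUnit.mul_left_cancel ?_)
  rw [h]
  exact (Matrix.mul_one _).symm

/-! ### The reduced space as a homogeneous space -/

/-- The level set `M⁻¹(J)` is the symplectic group. -/
def levelSetHomeomorph (d : ℕ) : LevelSet d ≃ₜ symplecticGroup (Fin d) ℝ where
  toFun S := ⟨S, S.mem_symplecticGroup⟩
  invFun S := ⟨S, momentum_eq_Jdual_iff.2 (mem_symplecticGroup_iff.1 S.2)⟩
  left_inv _ := rfl
  right_inv _ := rfl
  continuous_toFun := continuous_subtype_val.subtype_mk _
  continuous_invFun := continuous_subtype_val.subtype_mk _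

lemma orbit_iff_leftRel (S S' : LevelSet d) :
    orbitSetoid d S S' ↔
      QuotientGroup.leftRel (spOrthogonal d) (levelSetHomeomorph d S)
        (levelSetHomeomorph d S') := by
  rw [QuotientGroup.leftRel_apply]
  constructor
  · rintro ⟨R, hR, h⟩
    have h1 : levelSetHomeomorph d S' = levelSetHomeomorph d S * ⟨R, mem_isotropy_iff.1 hR⟩ :=
      Subtype.ext h
    rw [h1, inv_mul_cancel_left]
    exact R.2
  · intro h
    refine ⟨⟨_, h⟩, mem_isotropy_iff.2 ((levelSetHomeomorph d S)⁻¹ * levelSetHomeomorph d S').2, ?_⟩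
    exact congrArg Subtype.val
      (mul_inv_cancel_left (levelSetHomeomorph d S) (levelSetHomeomorph d S')).symm

/-- The reduced space is the homogeneous space `Sp(2d, ℝ) / (Sp(2d, ℝ) ∩ O(2d))`. -/
def reducedHomeomorph (d : ℕ) :
    Reduced d ≃ₜ symplecticGroup (Fin d) ℝ ⧸ spOrthogonal d where
  toEquiv := Quotient.congr (levelSetHomeomorph d).toEquiv orbit_iff_leftRel
  continuous_toFun := (levelSetHomeomorph d).continuous.quotient_map' fun S S' =>
    (orbit_iff_leftRel S S').1
  continuous_invFun := (levelSetHomeomorph d).symm.continuous.quotient_map' fun a b h =>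
    (orbit_iff_leftRel ((levelSetHomeomorph d).symm a) ((levelSetHomeomorph d).symm b)).2 h

/-! ### The orbit map onto the Siegel upper half space -/

lemma map_ofReal_mul {l m n : Type*} [Fintype m] (A : Matrix l m ℝ) (B : Matrix m n ℝ) :
    (A * B).map Complex.ofReal = A.map Complex.ofReal * B.map Complex.ofReal :=
  Matrix.map_mul (f := Complex.ofRealHom)

lemma map_ofReal_conj {m n : Type*} (A : Matrix m n ℝ) :
    (A.map Complex.ofReal).map (starRingEnd ℂ) = A.map Complex.ofReal := by
  ext i j
  simp

lemma map_ofReal_conjTranspose {m n : Type*} (A : Matrix m n ℝ) :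
    (A.map Complex.ofReal)ᴴ = Aᵀ.map Complex.ofReal := by
  ext i j
  simp

/-- The `2d × d` matrix `[I; iI]`. -/
def siegelBase (d : ℕ) : Matrix (Fin d ⊕ Fin d) (Fin d) ℂ := fromRows 1 (iI d)

/-- The matrix `C + D𝒳` for `S = [A B; C D]`. -/
def numer {d : ℕ} (S : Phase d) (X : Matrix (Fin d) (Fin d) ℂ) : Matrix (Fin d) (Fin d) ℂ :=
  S.toBlocks₂₁.map Complex.ofReal + S.toBlocks₂₂.map Complex.ofReal * X

lemma moebius_eq (S : Phase d) (X : Matrix (Fin d) (Fin d) ℂ) :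
    moebius S X = numer S X * (denom S X)⁻¹ := rfl

lemma map_mul_siegelBase (Z : Phase d) :
    Z.map Complex.ofReal * siegelBase d = fromRows (denom Z (iI d)) (numer Z (iI d)) := by
  conv_lhs => rw [← fromBlocks_toBlocks Z]
  rw [siegelBase, fromBlocks_map, fromBlocks_mul_fromRows, Matrix.mul_one, Matrix.mul_one]
  rfl

lemma map_J : (J d : Phase d).map Complex.ofReal =
    fromBlocks (0 : Matrix (Fin d) (Fin d) ℂ) 1 (-1) 0 := by
  rw [coe_J, fromBlocks_map, fromBlocks_inj]
  refine ⟨?_, ?_, ?_, ?_⟩ <;> ext i j <;> by_cases h : i = j <;> simp [h, one_apply]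

/-- The bilinear form `K` evaluated on the columns of `[I; iI]`. -/
def baseForm (K : Phase d) : Matrix (Fin d) (Fin d) ℂ :=
  (siegelBase d)ᵀ * K.map Complex.ofReal * siegelBase d

/-- `Z [I; iI]` is `denom` stacked over `numer`, and `J` pairs the stacks `[p; q]`, `[p'; q']` to
`pᵀ q' - qᵀ p'`. -/
lemma denom_transpose_mul_numer_sub (Z N : Phase d) :
    (denom Z (iI d))ᵀ * numer N (iI d) - (numer Z (iI d))ᵀ * denom N (iI d) =
      baseForm (Zᵀ * (J d : Phase d) * N) := by
  rw [baseForm, map_ofReal_mul, map_ofReal_mul,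
    show (siegelBase d)ᵀ * (Zᵀ.map Complex.ofReal * (J d : Phase d).map Complex.ofReal *
      N.map Complex.ofReal) * siegelBase d = (Z.map Complex.ofReal * siegelBase d)ᵀ *
      (J d : Phase d).map Complex.ofReal * (N.map Complex.ofReal * siegelBase d) by
      simp only [transpose_mul, transpose_map, Matrix.mul_assoc],
    map_mul_siegelBase, map_mul_siegelBase, map_J, transpose_fromRows, fromCols_mul_fromBlocks,
    fromCols_mul_fromRows]
  simp [sub_eq_add_neg, add_comm]

/-- The sesquilinear counterpart: `Z` is real, so its conjugate transpose is its transpose. -/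
lemma denom_conjTranspose_mul_numer_sub (Z N : Phase d) :
    (denom Z (iI d))ᴴ * numer N (iI d) - (numer Z (iI d))ᴴ * denom N (iI d) =
      (siegelBase d)ᴴ * (Zᵀ * (J d : Phase d) * N).map Complex.ofReal * siegelBase d := by
  rw [map_ofReal_mul, map_ofReal_mul,
    show (siegelBase d)ᴴ * (Zᵀ.map Complex.ofReal * (J d : Phase d).map Complex.ofReal *
      N.map Complex.ofReal) * siegelBase d = (Z.map Complex.ofReal * siegelBase d)ᴴ *
      (J d : Phase d).map Complex.ofReal * (N.map Complex.ofReal * siegelBase d) by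
      simp only [conjTranspose_mul, map_ofReal_conjTranspose, Matrix.mul_assoc],
    map_mul_siegelBase, map_mul_siegelBase, map_J, conjTranspose_fromRows_eq_fromCols_conjTranspose,
    fromCols_mul_fromBlocks, fromCols_mul_fromRows]
  simp [sub_eq_add_neg, add_comm]

lemma baseForm_fromBlocks (a b c e : Matrix (Fin d) (Fin d) ℝ) :
    baseForm (fromBlocks a b c e) =
      a.map Complex.ofReal - e.map Complex.ofReal +
        Complex.I • (b.map Complex.ofReal + c.map Complex.ofReal) := by
  rw [baseForm, siegelBase, fromBlocks_map, transpose_fromRows, fromCols_mul_fromBlocks,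
    fromCols_mul_fromRows, iI]
  simp only [transpose_one, transpose_smul, Matrix.one_mul, Matrix.mul_one, Matrix.smul_mul,
    Matrix.mul_smul, smul_add, smul_smul, Complex.I_mul_I, neg_smul, one_smul]
  abel

lemma baseForm_transpose (K : Phase d) : (baseForm K)ᵀ = baseForm Kᵀ := by
  simp [baseForm, transpose_map, Matrix.mul_assoc]

namespace LevelSet

variable (S : LevelSet d)

/-- The matrix `A + iB` for `S = [A B; C D]`. -/
abbrev den : Matrix (Fin d) (Fin d) ℂ := denom (S : Phase d) (iI d)

/-- The matrix `C + iD` for `S = [A B; C D]`. -/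
abbrev num : Matrix (Fin d) (Fin d) ℂ := numer (S : Phase d) (iI d)

/-- The columns of `[I; iI]` span an isotropic subspace for the bilinear form of `J`, and `S`
preserves that form. -/
lemma den_transpose_mul_num : S.denᵀ * S.num = S.numᵀ * S.den := by
  rw [← sub_eq_zero, denom_transpose_mul_numer_sub, S.transpose_J_mul, coe_J, baseForm_fromBlocks]
  ext i j
  by_cases h : i = j <;> simp [h]

lemma den_conjTranspose_mul_num_sub :
    S.denᴴ * S.num - S.numᴴ * S.den = (2 * Complex.I) • 1 := by
  rw [denom_conjTranspose_mul_numer_sub, S.transpose_J_mul, map_J, siegelBase,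
    conjTranspose_fromRows_eq_fromCols_conjTranspose, fromCols_mul_fromBlocks,
    fromCols_mul_fromRows, iI]
  simp [← two_smul ℂ, smul_smul]

/-- If `den x = 0`, then `x* (denᴴ num - numᴴ den) x` vanishes, but it equals `2i |x|²`. -/
lemma isUnit_den : IsUnit S.den := by
  rw [← mulVec_injective_iff_isUnit, ← coe_mulVecLin, ← LinearMap.ker_eq_bot,
    LinearMap.ker_eq_bot']
  intro x hx
  rw [mulVecLin_apply] at hx
  have h := congrArg (fun M => star x ⬝ᵥ M *ᵥ x) S.den_conjTranspose_mul_num_sub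
  simp only [sub_mulVec, ← mulVec_mulVec, hx, mulVec_zero, sub_zero] at h
  rw [dotProduct_mulVec, ← star_mulVec, hx, star_zero, zero_dotProduct, smul_mulVec, one_mulVec,
    dotProduct_smul, smul_eq_mul, eq_comm, mul_eq_zero] at h
  open scoped ComplexOrder in
  exact dotProduct_star_self_eq_zero.1 (h.resolve_left (by simp))

lemma den_mul_inv : S.den * S.den⁻¹ = 1 :=
  mul_nonsing_inv _ ((isUnit_iff_isUnit_det _).1 S.isUnit_den)

lemma den_inv_mul : S.den⁻¹ * S.den = 1 :=
  nonsing_inv_mul _ ((isUnit_iff_isUnit_det _).1 S.isUnit_den)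

lemma moebius_eq_num_mul : moebius (S : Phase d) (iI d) = S.num * S.den⁻¹ := rfl

lemma moebius_mul_den : moebius (S : Phase d) (iI d) * S.den = S.num := by
  rw [moebius_eq_num_mul, Matrix.mul_assoc, S.den_inv_mul, Matrix.mul_one]

lemma moebius_transpose :
    (moebius (S : Phase d) (iI d))ᵀ = moebius (S : Phase d) (iI d) := by
  have h : S.denᵀ⁻¹ * S.numᵀ * S.den = S.num := by
    rw [Matrix.mul_assoc, ← S.den_transpose_mul_num, ← Matrix.mul_assoc, ← transpose_nonsing_inv,
      ← transpose_mul, S.den_mul_inv, transpose_one, Matrix.one_mul]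
  rw [moebius_eq_num_mul, transpose_mul, transpose_nonsing_inv]
  conv_rhs => rw [← h, Matrix.mul_assoc, S.den_mul_inv, Matrix.mul_one]

/-- The point `Ψ_S(iI)` as a complex symmetric matrix. -/
def toSymC : SymC d := ⟨moebius (S : Phase d) (iI d), S.moebius_transpose⟩

lemma toSymC_mul_den : (S.toSymC : Matrix (Fin d) (Fin d) ℂ) * S.den = S.num :=
  S.moebius_mul_den

end LevelSet

lemma symC_transpose (X : SymC d) :
    (X : Matrix (Fin d) (Fin d) ℂ)ᵀ = (X : Matrix (Fin d) (Fin d) ℂ) := X.2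

lemma symC_sub_conjTranspose (X : SymC d) :
    (X : Matrix (Fin d) (Fin d) ℂ) - (X : Matrix (Fin d) (Fin d) ℂ)ᴴ =
      (2 * Complex.I) • (imPart X).map Complex.ofReal := by
  rw [conjTranspose, symC_transpose]
  ext i j
  simp only [Matrix.sub_apply, map_apply, Complex.star_def, Matrix.smul_apply, smul_eq_mul, imPart]
  apply Complex.ext <;> simp
  ring

namespace LevelSet

variable (S : LevelSet d)

/-- Substitute `num = 𝒳 den` in the sesquilinear identity and use `𝒳 - 𝒳ᴴ = 2i ℬ` for symmetric `𝒳`.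
-/
lemma den_conjTranspose_mul_imPart :
    S.denᴴ * ((imPart S.toSymC).map Complex.ofReal * S.den) = 1 := by
  have h := S.den_conjTranspose_mul_num_sub
  rw [← S.toSymC_mul_den, conjTranspose_mul, Matrix.mul_assoc, ← Matrix.mul_sub, ← Matrix.sub_mul,
    symC_sub_conjTranspose, Matrix.smul_mul, Matrix.mul_smul] at h
  exact smul_right_injective _ (by simp : (2 * Complex.I) ≠ 0) h

lemma imPart_mul_den_mul :
    (imPart S.toSymC).map Complex.ofReal * (S.den * S.denᴴ) = 1 := by
  rw [← Matrix.mul_assoc]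
  exact mul_eq_one_comm.1 S.den_conjTranspose_mul_imPart

lemma imPart_mul_re : imPart S.toSymC * (S.den * S.denᴴ).map Complex.re = 1 := by
  have h := congrArg (fun M => M.map Complex.re) S.imPart_mul_den_mul
  simp only [map_re_mul (imPart S.toSymC |>.map Complex.ofReal)] at h
  have h1 : ((imPart S.toSymC).map Complex.ofReal).map Complex.re = imPart S.toSymC := by
    ext; simp
  have h2 : ((imPart S.toSymC).map Complex.ofReal).map Complex.im = 0 := by
    ext; simp
  have h3 : (1 : Matrix (Fin d) (Fin d) ℂ).map Complex.re = 1 := by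
    ext i j; by_cases h : i = j <;> simp [h, one_apply]
  rwa [h1, h2, h3, Matrix.zero_mul, sub_zero] at h

/-- The inverse of the imaginary part is `Re (den denᴴ)`, a sum of two Gram matrices; being
invertible and positive semidefinite, it is positive definite. -/
lemma posDef_imPart : (imPart S.toSymC).PosDef := by
  have h1 := S.imPart_mul_re
  have h2 : ((S.den * S.denᴴ).map Complex.re).PosSemidef := by
    have h3 : (S.den * S.denᴴ).map Complex.re =
        S.den.map Complex.re * (S.den.map Complex.re)ᴴ +
          S.den.map Complex.im * (S.den.map Complex.im)ᴴ := by
      rw [map_re_mul]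
      ext i j
      simp [mul_apply]
    rw [h3]
    exact (posSemidef_self_mul_conjTranspose _).add (posSemidef_self_mul_conjTranspose _)
  have h4 : ((S.den * S.denᴴ).map Complex.re).PosDef :=
    h2.posDef_iff_isUnit.2 (IsUnit.of_mul_eq_one _ (mul_eq_one_comm.1 h1))
  rw [← inv_eq_left_inv h1]
  exact h4.inv

lemma toSymC_mem_siegel : S.toSymC ∈ Siegel d := S.posDef_imPart

lemma map_imPart_inv : (imPart S.toSymC)⁻¹.map Complex.ofReal = S.den * S.denᴴ := by
  have h : (imPart S.toSymC)⁻¹.map Complex.ofReal * (imPart S.toSymC).map Complex.ofReal = 1 := by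
    rw [← map_ofReal_mul, nonsing_inv_mul _ ((isUnit_iff_isUnit_det _).1 S.posDef_imPart.isUnit)]
    exact Matrix.map_one _ Complex.ofReal_zero Complex.ofReal_one
  calc _ = (imPart S.toSymC)⁻¹.map Complex.ofReal *
        ((imPart S.toSymC).map Complex.ofReal * (S.den * S.denᴴ)) := by
        rw [S.imPart_mul_den_mul, Matrix.mul_one]
    _ = _ := by rw [← Matrix.mul_assoc, h, Matrix.one_mul]

/-- A real matrix equals its conjugate, so `ℬ⁻¹` has two factorizations. In the Siegel metric one of
them is needed for each occurrence of `ℬ⁻¹`. -/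
lemma map_imPart_inv_eq_conj :
    (imPart S.toSymC)⁻¹.map Complex.ofReal = S.den.map (starRingEnd ℂ) * S.denᵀ := by
  rw [← map_ofReal_conj, S.map_imPart_inv, Matrix.map_mul]
  congr 1
  ext i j
  simp

end LevelSet

lemma exists_toSymC_eq {X : SymC d} (hX : X ∈ Siegel d) : ∃ S : LevelSet d, S.toSymC = X := by
  have hp : (imPart X).PosDef := hX
  obtain ⟨L, hL⟩ : ∃ L : Matrix (Fin d) (Fin d) ℝ, imPart X = Lᵀ * L := by
    open scoped MatrixOrder in
    obtain ⟨L, hL⟩ := CStarAlgebra.nonneg_iff_eq_star_mul_self.mp hp.posSemidef.nonneg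
    exact ⟨L, hL⟩
  have hu : IsUnit L.det := by
    have h := (isUnit_iff_isUnit_det _).1 hp.isUnit
    rw [hL, det_mul] at h
    exact isUnit_of_mul_isUnit_right h
  have hu' : IsUnit Lᵀ.det := by rwa [det_transpose]
  have hs : ((X : Matrix (Fin d) (Fin d) ℂ).map Complex.re)ᵀ =
      (X : Matrix (Fin d) (Fin d) ℂ).map Complex.re := by
    rw [← transpose_map, symC_transpose]
  have hdec : (X : Matrix (Fin d) (Fin d) ℂ) =
      ((X : Matrix (Fin d) (Fin d) ℂ).map Complex.re).map Complex.ofReal +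
        Complex.I • (imPart X).map Complex.ofReal := by
    ext i j
    simp [imPart, mul_comm Complex.I, Complex.re_add_im]
  generalize (X : Matrix (Fin d) (Fin d) ℂ).map Complex.re = A at hs hdec
  -- With `ℬ = Lᵀ L`, this block triangular matrix gives `(A L⁻¹ + i Lᵀ) L = A + i Lᵀ L`.
  refine ⟨⟨fromBlocks L⁻¹ 0 (A * L⁻¹) Lᵀ, ?_⟩, ?_⟩
  · rw [momentum_eq_Jdual_iff, coe_J, fromBlocks_transpose, fromBlocks_multiply,
      fromBlocks_multiply, fromBlocks_inj]
    simp [transpose_nonsing_inv, hs, Matrix.mul_assoc, mul_nonsing_inv _ hu,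
      nonsing_inv_mul _ hu']
  · refine Subtype.ext ?_
    have hLc : L⁻¹.map Complex.ofReal * L.map Complex.ofReal = 1 := by
      rw [← map_ofReal_mul, nonsing_inv_mul _ hu]
      exact Matrix.map_one _ Complex.ofReal_zero Complex.ofReal_one
    change moebius (fromBlocks L⁻¹ 0 (A * L⁻¹) Lᵀ) (iI d) = _
    rw [moebius_eq, numer, denom, toBlocks_fromBlocks₁₁, toBlocks_fromBlocks₁₂,
      toBlocks_fromBlocks₂₁, toBlocks_fromBlocks₂₂, Matrix.map_zero _ Complex.ofReal_zero,
      Matrix.zero_mul, add_zero, inv_eq_right_inv hLc, map_ofReal_mul, Matrix.add_mul,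
      Matrix.mul_assoc, hLc, Matrix.mul_one, hdec, hL, map_ofReal_mul, iI, Matrix.mul_smul,
      Matrix.mul_one, Matrix.smul_mul]

/-! ### The fibres of the orbit map -/

lemma map_add_I_smul_inj {m n : Type*} {A B A' B' : Matrix m n ℝ}
    (h : A.map Complex.ofReal + Complex.I • B.map Complex.ofReal =
      A'.map Complex.ofReal + Complex.I • B'.map Complex.ofReal) : A = A' ∧ B = B' := by
  constructor <;> ext i j
  · simpa using congrArg Complex.re (congrFun (congrFun h i) j)
  · simpa using congrArg Complex.im (congrFun (congrFun h i) j)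

lemma denom_iI (Z : Phase d) :
    denom Z (iI d) =
      Z.toBlocks₁₁.map Complex.ofReal + Complex.I • Z.toBlocks₁₂.map Complex.ofReal := by
  rw [denom, iI, Matrix.mul_smul, Matrix.mul_one]

lemma numer_iI (Z : Phase d) :
    numer Z (iI d) =
      Z.toBlocks₂₁.map Complex.ofReal + Complex.I • Z.toBlocks₂₂.map Complex.ofReal := by
  rw [numer, iI, Matrix.mul_smul, Matrix.mul_one]

lemma iI_mul (M : Matrix (Fin d) (Fin d) ℂ) : iI d * M = Complex.I • M := by
  rw [iI, Matrix.smul_mul, Matrix.one_mul]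

/-- The columns of `[I; iI]` span the `i`-eigenspace of `J`. A real matrix preserving it also
preserves the conjugate eigenspace, hence commutes with `J`; in blocks this is a comparison of real
and imaginary parts. -/
lemma mul_J_of_map_mul_siegelBase {R : Phase d} {u : Matrix (Fin d) (Fin d) ℂ}
    (h : R.map Complex.ofReal * siegelBase d = siegelBase d * u) :
    R * (J d : Phase d) = (J d : Phase d) * R := by
  rw [map_mul_siegelBase, siegelBase, fromRows_mul] at h
  obtain ⟨h1, h2⟩ := fromRows_inj h
  rw [Matrix.one_mul] at h1
  rw [← h1, iI_mul, numer_iI, denom_iI] at h2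
  obtain ⟨h3, h4⟩ : R.toBlocks₂₁ = -R.toBlocks₁₂ ∧ R.toBlocks₂₂ = R.toBlocks₁₁ := by
    apply map_add_I_smul_inj
    rw [h2, smul_add, smul_smul, Complex.I_mul_I]
    ext i j
    simp [add_comm]
  rw [← fromBlocks_toBlocks R, h3, h4, coe_J, fromBlocks_multiply, fromBlocks_multiply]
  simp

lemma map_mul_siegelBase_of_mul_J {R : Phase d}
    (h : R * (J d : Phase d) = (J d : Phase d) * R) :
    R.map Complex.ofReal * siegelBase d = siegelBase d * denom R (iI d) := by
  rw [← fromBlocks_toBlocks R, coe_J, fromBlocks_multiply, fromBlocks_multiply,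
    fromBlocks_inj] at h
  simp only [Matrix.mul_zero, Matrix.mul_neg, Matrix.mul_one, zero_add, Matrix.zero_mul,
    Matrix.one_mul, add_zero, Matrix.neg_mul] at h
  rw [map_mul_siegelBase, siegelBase, fromRows_mul, Matrix.one_mul, iI_mul, numer_iI, denom_iI, ← h.1, ← h.2.1, smul_add, smul_smul, Complex.I_mul_I]
  congr 1
  ext i j
  simp [add_comm]

lemma toSymC_eq_iff (S S' : LevelSet d) : S.toSymC = S'.toSymC ↔ orbitSetoid d S S' := by
  constructor
  · intro h
    have hS := (isUnit_iff_isUnit_det _).1 S.isUnit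
    have hR : (S : Phase d) * ((S : Phase d)⁻¹ * (S' : Phase d)) = S' := by
      rw [← Matrix.mul_assoc, mul_nonsing_inv _ hS, Matrix.one_mul]
    -- Equal points mean that `S [I; iI]` and `S' [I; iI]` have the same column span, with change of
    -- basis `den⁻¹ den'`.
    have hR' : ((S : Phase d)⁻¹ * (S' : Phase d)).map Complex.ofReal * siegelBase d =
        siegelBase d * (S.den⁻¹ * S'.den) := by
      have h1 : (S' : Phase d).map Complex.ofReal * siegelBase d =
          (S : Phase d).map Complex.ofReal * (siegelBase d * (S.den⁻¹ * S'.den)) := by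
        rw [← Matrix.mul_assoc, map_mul_siegelBase, map_mul_siegelBase, fromRows_mul]
        change fromRows S'.den S'.num = _
        rw [← Matrix.mul_assoc, S.den_mul_inv, Matrix.one_mul, ← S'.toSymC_mul_den, ← h,
          ← Matrix.mul_assoc]
        rfl
      rw [map_ofReal_mul, Matrix.mul_assoc, h1, ← Matrix.mul_assoc, ← map_ofReal_mul,
        nonsing_inv_mul _ hS, Matrix.map_one _ Complex.ofReal_zero Complex.ofReal_one,
        Matrix.one_mul]
    generalize (S : Phase d)⁻¹ * (S' : Phase d) = R at hR hR'
    have hsymp : Rᵀ * (J d : Phase d) * R = (J d : Phase d) := by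
      have h1 := S'.transpose_J_mul
      rw [← hR, transpose_mul, show Rᵀ * (S : Phase d)ᵀ * (J d : Phase d) * ((S : Phase d) * R) =
        Rᵀ * ((S : Phase d)ᵀ * (J d : Phase d) * (S : Phase d)) * R by
          simp only [Matrix.mul_assoc], S.transpose_J_mul] at h1
      exact h1
    -- `Rᵀ J R = J` and `R J = J R` give `Rᵀ R J = J`; multiplying by `-J` removes `J`.
    have horth : Rᵀ * R = 1 := by
      have h2 := hsymp
      rw [Matrix.mul_assoc, ← mul_J_of_map_mul_siegelBase hR', ← Matrix.mul_assoc] at h2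
      have h3 := congrArg (fun M => -(M * (J d : Phase d))) h2
      simpa [Matrix.mul_assoc, J_mul_J] using h3
    exact ⟨⟨R, mem_unitaryGroup_iff'.2 horth⟩, mem_isotropy_iff_transpose.2 hsymp, hR.symm⟩
  · rintro ⟨R, hR, h⟩
    have h1 := map_mul_siegelBase_of_mul_J (commute_J_of_mem_isotropy hR)
    -- Passing from `S` to `S R` multiplies `den` and `num` on the right by the same matrix, so the
    -- quotient is unchanged.
    have h2 : (S' : Phase d).map Complex.ofReal * siegelBase d =
        (S : Phase d).map Complex.ofReal * siegelBase d * denom (R : Phase d) (iI d) := by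
      rw [h, map_ofReal_mul, Matrix.mul_assoc, h1, Matrix.mul_assoc]
    rw [map_mul_siegelBase, map_mul_siegelBase, fromRows_mul] at h2
    obtain ⟨h3, h4⟩ := fromRows_inj h2
    refine Subtype.ext ?_
    have h5 : (S.toSymC : Matrix (Fin d) (Fin d) ℂ) * S'.den = S'.num := by
      change _ * denom (S' : Phase d) (iI d) = numer (S' : Phase d) (iI d)
      rw [h3, h4, ← Matrix.mul_assoc]
      congr 1
      exact S.toSymC_mul_den
    calc (S.toSymC : Matrix (Fin d) (Fin d) ℂ)
        = S.toSymC * S'.den * S'.den⁻¹ := by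
          rw [Matrix.mul_assoc, S'.den_mul_inv, Matrix.mul_one]
      _ = S'.toSymC := by rw [h5]; rfl

/-! ### The derivative of the orbit map -/

/-- The symmetrization `X ↦ (X + Xᵀ) / 2`. -/
def symProj (d : ℕ) : Matrix (Fin d) (Fin d) ℂ →L[ℝ] SymC d :=
  LinearMap.toContinuousLinearMap
    { toFun := fun X => ⟨(1 / 2 : ℝ) • (X + Xᵀ), by
        change ((1 / 2 : ℝ) • (X + Xᵀ))ᵀ = _
        rw [transpose_smul, transpose_add, transpose_transpose, add_comm]⟩
      map_add' := fun X Y => Subtype.ext (by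
        change (1 / 2 : ℝ) • (X + Y + (X + Y)ᵀ) = (1 / 2 : ℝ) • (X + Xᵀ) + (1 / 2 : ℝ) • (Y + Yᵀ)
        rw [transpose_add, ← smul_add]
        congr 1
        abel)
      map_smul' := fun c X => Subtype.ext (by
        change (1 / 2 : ℝ) • (c • X + (c • X)ᵀ) = c • (1 / 2 : ℝ) • (X + Xᵀ)
        rw [transpose_smul, ← smul_add, smul_comm]) }

lemma symProj_coe (X : SymC d) : symProj d (X : Matrix (Fin d) (Fin d) ℂ) = X := by
  refine Subtype.ext ?_
  change (1 / 2 : ℝ) • ((X : Matrix (Fin d) (Fin d) ℂ) + (X : Matrix (Fin d) (Fin d) ℂ)ᵀ) = X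
  rw [symC_transpose, ← two_smul ℝ, smul_smul]
  norm_num

/-- `Z ↦ A + iB` as a continuous linear map. -/
def denomCLM (d : ℕ) : Phase d →L[ℝ] Matrix (Fin d) (Fin d) ℂ :=
  LinearMap.toContinuousLinearMap
    { toFun := fun Z => denom Z (iI d)
      map_add' := fun X Y => by
        simp only [denom_iI]; ext i j; simp [toBlocks₁₁, toBlocks₁₂]; ring
      map_smul' := fun c X => by
        simp only [denom_iI]; ext i j; simp [toBlocks₁₁, toBlocks₁₂]; ring }

/-- `Z ↦ C + iD` as a continuous linear map. -/
def numerCLM (d : ℕ) : Phase d →L[ℝ] Matrix (Fin d) (Fin d) ℂ :=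
  LinearMap.toContinuousLinearMap
    { toFun := fun Z => numer Z (iI d)
      map_add' := fun X Y => by
        simp only [numer_iI]; ext i j; simp [toBlocks₂₁, toBlocks₂₂]; ring
      map_smul' := fun c X => by
        simp only [numer_iI]; ext i j; simp [toBlocks₂₁, toBlocks₂₂]; ring }

@[simp] lemma denomCLM_apply (Z : Phase d) : denomCLM d Z = denom Z (iI d) := rfl

/-- The map `Z ↦ Ψ_Z(iI)`, followed by the projection to symmetric matrices. -/
def siegelMap (Z : Phase d) : SymC d := symProj d (moebius Z (iI d))

/-- The symmetrization in `siegelMap` is invisible on the level set. It extends the orbit map, with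
values in `SymC d`, to the ambient space, where ordinary derivatives can be taken. -/
lemma siegelMap_coe (S : LevelSet d) : siegelMap (S : Phase d) = S.toSymC :=
  symProj_coe S.toSymC

lemma siegelMap_eq :
    siegelMap (d := d) = fun Z => symProj d (numerCLM d Z * Ring.inverse (denomCLM d Z)) := by
  ext1 Z
  rw [siegelMap, moebius_eq, nonsing_inv_eq_ringInverse]
  rfl

lemma contDiffAt_siegelMap {Z : Phase d} (hZ : IsUnit (denom Z (iI d))) :
    ContDiffAt ℝ ∞ (siegelMap (d := d)) Z := by
  rw [siegelMap_eq]
  obtain ⟨u, hu⟩ := hZ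
  have h1 : ContDiffAt ℝ ∞ (Ring.inverse : Matrix (Fin d) (Fin d) ℂ → _) (denomCLM d Z) := by
    rw [denomCLM_apply, ← hu]
    exact contDiffAt_ringInverse ℝ u
  exact (symProj d).contDiff.contDiffAt.comp Z ((numerCLM d).contDiff.contDiffAt.mul
    (h1.comp Z (denomCLM d).contDiff.contDiffAt))

lemma hasFDerivAt_mul_ringInverse {E A : Type*} [NormedAddCommGroup E] [NormedSpace ℝ E]
    [NormedRing A] [NormedAlgebra ℝ A] [CompleteSpace A] (f g : E →L[ℝ] A) (z : E) (u : Aˣ)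
    (hu : (u : A) = g z) :
    ∃ L : E →L[ℝ] A, HasFDerivAt (fun z => f z * Ring.inverse (g z)) L z ∧
      ∀ w, L w = f w * (u⁻¹ : Aˣ) - f z * (u⁻¹ : Aˣ) * g w * (u⁻¹ : Aˣ) := by
  have h1 : HasFDerivAt (Ring.inverse : A → A)
      (-(ContinuousLinearMap.mulLeftRight ℝ A) (u⁻¹ : Aˣ) (u⁻¹ : Aˣ)) (g z) := by
    rw [← hu]
    exact hasFDerivAt_ringInverse u
  refine ⟨_, f.hasFDerivAt.mul' (h1.comp z g.hasFDerivAt), fun w => ?_⟩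
  simp [← hu, mul_assoc, sub_eq_neg_add]

lemma fderiv_siegelMap {Z : Phase d} (hZ : IsUnit (denom Z (iI d))) (N : Phase d) :
    fderiv ℝ (siegelMap (d := d)) Z N =
      symProj d (numer N (iI d) * (denom Z (iI d))⁻¹ -
        moebius Z (iI d) * denom N (iI d) * (denom Z (iI d))⁻¹) := by
  obtain ⟨u, hu⟩ := hZ
  obtain ⟨L, hL, hLN⟩ := hasFDerivAt_mul_ringInverse (numerCLM d) (denomCLM d) Z u hu
  have hui : ((u⁻¹ : (Matrix (Fin d) (Fin d) ℂ)ˣ) : Matrix (Fin d) (Fin d) ℂ) =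
      (denom Z (iI d))⁻¹ := by
    rw [← hu, coe_units_inv]
  have h2 := (symProj d).hasFDerivAt.comp Z hL
  rw [siegelMap_eq]
  refine (congrArg (fun L => L N) h2.fderiv).trans ?_
  rw [ContinuousLinearMap.comp_apply, hLN, hui, moebius_eq]
  rfl

lemma spLie_transpose_mul {X : Phase d} (hX : X ∈ spLie d) :
    Xᵀ * (J d : Phase d) = -((J d : Phase d) * X) :=
  eq_neg_of_add_eq_zero_left hX

lemma spLie_J_mul_symm {X : Phase d} (hX : X ∈ spLie d) :
    ((J d : Phase d) * X)ᵀ = (J d : Phase d) * X := by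
  rw [transpose_mul, J_transpose, Matrix.mul_neg, spLie_transpose_mul hX, neg_neg]

namespace LevelSet

variable (S : LevelSet d)

lemma den_transpose_inv_mul (M : Matrix (Fin d) (Fin d) ℂ) :
    S.den⁻¹ᵀ * (S.denᵀ * M) = M := by
  rw [← Matrix.mul_assoc, ← transpose_mul, S.den_mul_inv, transpose_one, Matrix.one_mul]

/-- The derivative of `S ↦ Ψ_S(iI)` at `S` in the direction `S X`, as a function of
`X ∈ sp(2d, ℝ)`. -/
def tangentMap (X : spLie d) : SymC d :=
  ⟨S.den⁻¹ᵀ * baseForm ((J d : Phase d) * (X : Phase d)) * S.den⁻¹, by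
    change (_ : Matrix (Fin d) (Fin d) ℂ)ᵀ = _
    rw [transpose_mul, transpose_mul, baseForm_transpose, spLie_J_mul_symm X.2,
      transpose_transpose, Matrix.mul_assoc]⟩

/-- By symmetry `Ψ_S(iI) = den⁻ᵀ numᵀ`, so the quotient rule yields `den⁻ᵀ (denᵀ numer N - numᵀ
denom N) den⁻¹` for `N = S X`, and the bracket is `baseForm (Sᵀ J S X) = baseForm (J X)`. -/
lemma fderiv_siegelMap_apply (X : spLie d) :
    fderiv ℝ (siegelMap (d := d)) (S : Phase d) ((S : Phase d) * (X : Phase d)) =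
      S.tangentMap X := by
  rw [fderiv_siegelMap S.isUnit_den, ← symProj_coe (S.tangentMap X)]
  congr 1
  change _ = S.den⁻¹ᵀ * baseForm ((J d : Phase d) * (X : Phase d)) * S.den⁻¹
  have h := denom_transpose_mul_numer_sub (S : Phase d) ((S : Phase d) * (X : Phase d))
  rw [← Matrix.mul_assoc, S.transpose_J_mul] at h
  rw [← h, Matrix.mul_sub, S.den_transpose_inv_mul, Matrix.sub_mul, ← Matrix.mul_assoc,
    ← transpose_mul]
  congr 3
  exact S.moebius_transpose.symm

lemma tangentMap_surjective : Function.Surjective S.tangentMap := by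
  intro V
  have hV := symC_transpose V
  have hW : (S.denᵀ * (V : Matrix (Fin d) (Fin d) ℂ) * S.den)ᵀ =
      S.denᵀ * (V : Matrix (Fin d) (Fin d) ℂ) * S.den := by
    rw [transpose_mul, transpose_mul, hV, transpose_transpose, Matrix.mul_assoc]
  have hback : S.den⁻¹ᵀ * (S.denᵀ * (V : Matrix (Fin d) (Fin d) ℂ) * S.den) * S.den⁻¹ = V := by
    rw [Matrix.mul_assoc, Matrix.mul_assoc _ S.den, S.den_mul_inv, Matrix.mul_one,
      S.den_transpose_inv_mul]
  generalize S.denᵀ * (V : Matrix (Fin d) (Fin d) ℂ) * S.den = W at hW hback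
  have hre : (W.map Complex.re)ᵀ = W.map Complex.re := by rw [← transpose_map, hW]
  have him : (W.map Complex.im)ᵀ = W.map Complex.im := by rw [← transpose_map, hW]
  -- `baseForm` sends `[a b; c e]` to `a - e + i(b + c)`; the symmetric choice `a = Re W`, `b = c =
  -- ½ Im W`, `e = 0` hits `W`, and `X` is recovered from `J X`.
  have hJX : (J d : Phase d) * fromBlocks (-(1 / 2 : ℝ) • W.map Complex.im) 0
      (W.map Complex.re) ((1 / 2 : ℝ) • W.map Complex.im) =
      fromBlocks (W.map Complex.re) ((1 / 2 : ℝ) • W.map Complex.im)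
        ((1 / 2 : ℝ) • W.map Complex.im) 0 := by
    rw [coe_J, fromBlocks_multiply]
    simp
  refine ⟨⟨fromBlocks (-(1 / 2 : ℝ) • W.map Complex.im) 0 (W.map Complex.re)
    ((1 / 2 : ℝ) • W.map Complex.im), ?_⟩, Subtype.ext ?_⟩
  · change _ + _ = 0
    have h : ((J d : Phase d) * fromBlocks (-(1 / 2 : ℝ) • W.map Complex.im) 0
      (W.map Complex.re) ((1 / 2 : ℝ) • W.map Complex.im))ᵀ = (J d : Phase d) *
      fromBlocks (-(1 / 2 : ℝ) • W.map Complex.im) 0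
      (W.map Complex.re) ((1 / 2 : ℝ) • W.map Complex.im) := by
      rw [hJX, fromBlocks_transpose, transpose_smul, him, hre, transpose_zero]
    rw [transpose_mul, J_transpose, Matrix.mul_neg] at h
    rw [← h, add_neg_cancel]
  · change S.den⁻¹ᵀ * baseForm ((J d : Phase d) * fromBlocks _ _ _ _) * S.den⁻¹ = _
    rw [hJX, baseForm_fromBlocks]
    refine Eq.trans ?_ hback
    congr 2
    ext i j
    apply Complex.ext <;> simp
    ring

end LevelSet

/-! ### Comparison of the two-forms -/

lemma OmegaSiegel_apply (X : SymC d) (v : Fin 2 → SymC d) :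
    OmegaSiegel X v = (siegelMetric X (v 0) (v 1)).im := rfl

lemma baseForm_J_mul_spLie (X : spLie d) :
    baseForm ((J d : Phase d) * (X : Phase d)) =
      ((X : Phase d).toBlocks₂₁ + (X : Phase d).toBlocks₁₂).map Complex.ofReal +
        Complex.I • ((X : Phase d).toBlocks₂₂ - (X : Phase d).toBlocks₁₁).map Complex.ofReal := by
  rw [← fromBlocks_toBlocks (X : Phase d), coe_J, fromBlocks_multiply, baseForm_fromBlocks]
  ext i j
  simp [sub_eq_add_neg, mul_add]

lemma im_trace_mul_conj (P Q P' Q' : Matrix (Fin d) (Fin d) ℝ) :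
    ((P.map Complex.ofReal + Complex.I • Q.map Complex.ofReal) *
      (P'.map Complex.ofReal + Complex.I • Q'.map Complex.ofReal).map (starRingEnd ℂ)).trace.im =
      (Q * P').trace - (P * Q').trace := by
  simp only [trace, diag, Complex.im_sum, mul_apply, ← Finset.sum_sub_distrib]
  refine Finset.sum_congr rfl fun i _ => Finset.sum_congr rfl fun j _ => ?_
  simp
  ring

/-- The metric is invariant, so it reduces to `tr(w w̄')` for the two base forms; what remains is an
identity between traces of blocks of `X` and `Y`. -/
lemma OmegaSiegel_tangentMap (S : LevelSet d) (X Y : spLie d) :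
    (siegelMetric S.toSymC (S.tangentMap X) (S.tangentMap Y)).im =
      -2 * ((X : Phase d)ᵀ * (J d : Phase d) * (Y : Phase d)).trace := by
  have hmetric : siegelMetric S.toSymC (S.tangentMap X) (S.tangentMap Y) =
      (baseForm ((J d : Phase d) * (X : Phase d)) *
        (baseForm ((J d : Phase d) * (Y : Phase d))).map (starRingEnd ℂ)).trace := by
    have hc : ∀ M : Matrix (Fin d) (Fin d) ℂ, (Mᵀ).map (starRingEnd ℂ) = Mᴴ := fun M => rfl
    have h1 : S.den⁻¹.map (starRingEnd ℂ) * S.den.map (starRingEnd ℂ) = 1 := by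
      rw [← Matrix.map_mul, S.den_inv_mul]
      exact Matrix.map_one _ (map_zero _) (map_one _)
    have h2 : S.denᴴ * S.den⁻¹ᴴ = 1 := by
      rw [← conjTranspose_mul, S.den_inv_mul, conjTranspose_one]
    rw [siegelMetric]
    -- The first `ℬ⁻¹` becomes `conj(den) denᵀ` and the second `den denᴴ`, so that each factor meets
    -- its inverse from the tangent vectors.
    nth_rewrite 1 [S.map_imPart_inv_eq_conj]
    rw [S.map_imPart_inv]
    change (S.den.map (starRingEnd ℂ) * S.denᵀ *
      (S.den⁻¹ᵀ * baseForm ((J d : Phase d) * (X : Phase d)) * S.den⁻¹) * (S.den * S.denᴴ) *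
      (S.den⁻¹ᵀ * baseForm ((J d : Phase d) * (Y : Phase d)) * S.den⁻¹).map
        (starRingEnd ℂ)).trace = _
    rw [Matrix.map_mul, Matrix.map_mul, hc]
    generalize baseForm ((J d : Phase d) * (X : Phase d)) = w
    generalize (baseForm ((J d : Phase d) * (Y : Phase d))).map (starRingEnd ℂ) = w'
    have h3 : S.denᵀ * S.den⁻¹ᵀ = 1 := by
      rw [← transpose_mul, S.den_inv_mul, transpose_one]
    calc _ = (S.den.map (starRingEnd ℂ) * ((S.denᵀ * S.den⁻¹ᵀ) * w * (S.den⁻¹ * S.den) *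
          (S.denᴴ * S.den⁻¹ᴴ) * w' * S.den⁻¹.map (starRingEnd ℂ))).trace := by
          simp only [Matrix.mul_assoc]
      _ = _ := by
          rw [h3, S.den_inv_mul, h2, trace_mul_comm, Matrix.mul_assoc, h1]
          simp
  have hX := spLie_transpose_mul X.2
  rw [hmetric, hX, baseForm_J_mul_spLie, baseForm_J_mul_spLie, im_trace_mul_conj]
  have hXs := spLie_J_mul_symm X.2
  have hYs := spLie_J_mul_symm Y.2
  rw [← fromBlocks_toBlocks (X : Phase d), coe_J, fromBlocks_multiply, fromBlocks_transpose,
    fromBlocks_inj] at hXs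
  rw [← fromBlocks_toBlocks (Y : Phase d), coe_J, fromBlocks_multiply, fromBlocks_transpose,
    fromBlocks_inj] at hYs
  have htr : ((J d : Phase d) * (X : Phase d) * (Y : Phase d)).trace =
      ((X : Phase d).toBlocks₂₁ * (Y : Phase d).toBlocks₁₁ +
        (X : Phase d).toBlocks₂₂ * (Y : Phase d).toBlocks₂₁).trace +
      (-((X : Phase d).toBlocks₁₁ * (Y : Phase d).toBlocks₁₂) -
        (X : Phase d).toBlocks₁₂ * (Y : Phase d).toBlocks₂₂).trace := by
    conv_lhs => rw [← fromBlocks_toBlocks (X : Phase d), ← fromBlocks_toBlocks (Y : Phase d)]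
    rw [coe_J, fromBlocks_multiply, fromBlocks_multiply, Matrix.trace, Fintype.sum_sum_type]
    simp [Matrix.trace, sub_eq_add_neg]
  rw [Matrix.neg_mul, trace_neg, htr]
  simp only [Matrix.zero_mul, Matrix.one_mul, zero_add, add_zero, Matrix.neg_mul, transpose_neg,
    neg_inj] at hXs hYs
  obtain ⟨hX1, hX2, -, hX4⟩ := hXs
  obtain ⟨hY1, hY2, -, hY4⟩ := hYs
  generalize (X : Phase d).toBlocks₁₁ = a at *
  generalize (X : Phase d).toBlocks₁₂ = b at *
  generalize (X : Phase d).toBlocks₂₁ = c at *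
  generalize (X : Phase d).toBlocks₂₂ = e at *
  generalize (Y : Phase d).toBlocks₁₁ = a' at *
  generalize (Y : Phase d).toBlocks₁₂ = b' at *
  generalize (Y : Phase d).toBlocks₂₁ = c' at *
  generalize (Y : Phase d).toBlocks₂₂ = e' at *
  have hs : ∀ A B : Matrix (Fin d) (Fin d) ℝ, Bᵀ = B → (-Aᵀ * B).trace = -(A * B).trace := by
    intro A B hB
    rw [Matrix.neg_mul, trace_neg, ← trace_transpose, transpose_mul, hB, transpose_transpose,
      trace_mul_comm]
  have hs' : ∀ A B : Matrix (Fin d) (Fin d) ℝ, Bᵀ = B → (B * -Aᵀ).trace = -(B * A).trace := by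
    intro A B hB
    rw [trace_mul_comm, hs A B hB, trace_mul_comm]
  -- In blocks `[a b; c e]`, membership in `sp(2d, ℝ)` says that `b`, `c` are symmetric and `e =
  -- -aᵀ`. After eliminating `e`, the remaining transposes disappear against symmetric factors.
  subst hX2 hY2
  simp only [Matrix.add_mul, Matrix.sub_mul, Matrix.mul_add, Matrix.mul_sub, trace_add, trace_sub,
    trace_neg, hs _ _ hY1, hs _ _ hY4, hs' _ _ hX1, hs' _ _ hX4]
  ring

/-! ### The symplectic form of the Siegel upper half space -/

/-- Evaluation on pairs of basis vectors embeds the two-forms linearly in a finite dimensional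
coordinate space; a linear left inverse recovers `η` from its smooth coordinates. -/
lemma contDiffOn_of_apply {E F : Type*} [NormedAddCommGroup E] [NormedSpace ℝ E]
    [FiniteDimensional ℝ E] [NormedAddCommGroup F] [NormedSpace ℝ F]
    {η : F → E [⋀^Fin 2]→L[ℝ] ℝ} {s : Set F} {n : ℕ∞ω}
    (h : ∀ v, ContDiffOn ℝ n (fun x => η x v) s) : ContDiffOn ℝ n η s := by
  let b := Module.finBasis ℝ E
  let L : (E [⋀^Fin 2]→L[ℝ] ℝ) →ₗ[ℝ] ((Fin 2 → Fin (Module.finrank ℝ E)) → ℝ) :=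
    { toFun := fun α i => α fun k => b (i k)
      map_add' := fun _ _ => rfl
      map_smul' := fun _ _ => rfl }
  have hL : LinearMap.ker L = ⊥ := by
    refine LinearMap.ker_eq_bot'.2 fun α hα => ?_
    have h0 : (α.toAlternatingMap : MultilinearMap ℝ (fun _ : Fin 2 => E) ℝ) = 0 :=
      Module.Basis.ext_multilinear (fun _ => b) fun i => congrFun hα i
    ext v
    exact congrArg (fun m : MultilinearMap ℝ (fun _ : Fin 2 => E) ℝ => m v) h0
  obtain ⟨T, hT⟩ := L.exists_leftInverse_of_injective hL
  have hη : η = fun x => LinearMap.toContinuousLinearMap T (L (η x)) := by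
    ext1 x
    exact (LinearMap.congr_fun hT (η x)).symm
  rw [hη]
  exact (LinearMap.toContinuousLinearMap T).contDiff.comp_contDiffOn
    (contDiffOn_pi.2 fun i => h _)

/-- The real part of a complex symmetric matrix. -/
def rePart (X : SymC d) : Matrix (Fin d) (Fin d) ℝ :=
  (X : Matrix (Fin d) (Fin d) ℂ).map Complex.re

lemma rePart_transpose (X : SymC d) : (rePart X)ᵀ = rePart X := by
  rw [rePart, ← transpose_map, symC_transpose]

lemma imPart_transpose (X : SymC d) : (imPart X)ᵀ = imPart X := by
  rw [imPart, ← transpose_map, symC_transpose]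

lemma symC_eq_re_add_im (X : SymC d) :
    (X : Matrix (Fin d) (Fin d) ℂ) =
      (rePart X).map Complex.ofReal + Complex.I • (imPart X).map Complex.ofReal := by
  ext i j
  simp [imPart, rePart, mul_comm Complex.I, Complex.re_add_im]

/-- The complex symmetric matrix with given real and imaginary parts. -/
def symCMk (A B : Matrix (Fin d) (Fin d) ℝ) (hA : Aᵀ = A) (hB : Bᵀ = B) : SymC d :=
  ⟨A.map Complex.ofReal + Complex.I • B.map Complex.ofReal, by
    change _ᵀ = _
    rw [transpose_add, transpose_smul, ← transpose_map, ← transpose_map, hA, hB]⟩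

lemma rePart_symCMk (A B : Matrix (Fin d) (Fin d) ℝ) (hA : Aᵀ = A) (hB : Bᵀ = B) :
    rePart (symCMk A B hA hB) = A := by
  ext i j
  simp [rePart, symCMk]

lemma imPart_symCMk (A B : Matrix (Fin d) (Fin d) ℝ) (hA : Aᵀ = A) (hB : Bᵀ = B) :
    imPart (symCMk A B hA hB) = B := by
  ext i j
  simp [imPart, symCMk]

lemma im_siegelMetric (X V W : SymC d) :
    (siegelMetric X V W).im =
      ((imPart X)⁻¹ * imPart V * (imPart X)⁻¹ * rePart W).trace -
        ((imPart X)⁻¹ * rePart V * (imPart X)⁻¹ * imPart W).trace := by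
  have h : (imPart X)⁻¹.map Complex.ofReal * (V : Matrix (Fin d) (Fin d) ℂ) *
      (imPart X)⁻¹.map Complex.ofReal =
      ((imPart X)⁻¹ * rePart V * (imPart X)⁻¹).map Complex.ofReal +
        Complex.I • ((imPart X)⁻¹ * imPart V * (imPart X)⁻¹).map Complex.ofReal := by
    rw [symC_eq_re_add_im V]
    simp only [map_ofReal_mul, Matrix.mul_add, Matrix.add_mul, Matrix.mul_smul, Matrix.smul_mul]
  rw [siegelMetric, h, symC_eq_re_add_im W, im_trace_mul_conj]

/-- The imaginary part as a continuous linear map. -/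
def imPartCLM (d : ℕ) : SymC d →L[ℝ] Matrix (Fin d) (Fin d) ℝ :=
  LinearMap.toContinuousLinearMap
    { toFun := imPart
      map_add' := fun X Y => by ext i j; simp [imPart]
      map_smul' := fun c X => by ext i j; simp [imPart] }

@[simp] lemma imPartCLM_apply (X : SymC d) : imPartCLM d X = imPart X := rfl

/-- The trace as a continuous linear map. -/
def traceCLM (d : ℕ) : Matrix (Fin d) (Fin d) ℝ →L[ℝ] ℝ :=
  LinearMap.toContinuousLinearMap (traceLinearMap (Fin d) ℝ ℝ)

@[simp] lemma traceCLM_apply (A : Matrix (Fin d) (Fin d) ℝ) : traceCLM d A = A.trace := rfl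

/-! ### Differentiation of traces quadratic in an inverse -/

section Quadratic

variable {E A : Type*} [NormedAddCommGroup E] [NormedSpace ℝ E] [NormedRing A]
  [NormedAlgebra ℝ A] [CompleteSpace A]

lemma contDiffAt_ringInverse_mul_mul {n : ℕ∞ω} (τ : A →L[ℝ] ℝ) (g : E →L[ℝ] A) (a b : A) (z : E)
    (hz : IsUnit (g z)) :
    ContDiffAt ℝ n (fun z => τ (Ring.inverse (g z) * a * Ring.inverse (g z) * b)) z := by
  obtain ⟨u, hu⟩ := hz
  have h0 : ContDiffAt ℝ n (Ring.inverse : A → A) (g z) := by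
    rw [← hu]
    exact contDiffAt_ringInverse ℝ u
  have h1 := h0.comp z g.contDiff.contDiffAt
  exact τ.contDiff.contDiffAt.comp z
    (((h1.mul contDiffAt_const).mul h1).mul contDiffAt_const)

lemma hasFDerivAt_ringInverse_mul_mul (τ : A →L[ℝ] ℝ) (g : E →L[ℝ] A) (a b : A) (z : E) (u : Aˣ)
    (hu : (u : A) = g z) :
    ∃ L : E →L[ℝ] ℝ,
      HasFDerivAt (fun z => τ (Ring.inverse (g z) * a * Ring.inverse (g z) * b)) L z ∧
      ∀ w, L w = -(τ ((u⁻¹ : Aˣ) * g w * ((u⁻¹ : Aˣ) * a) * ((u⁻¹ : Aˣ) * b)) +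
        τ ((u⁻¹ : Aˣ) * a * ((u⁻¹ : Aˣ) * g w) * ((u⁻¹ : Aˣ) * b))) := by
  have h1 : HasFDerivAt (Ring.inverse : A → A)
      (-(ContinuousLinearMap.mulLeftRight ℝ A) (u⁻¹ : Aˣ) (u⁻¹ : Aˣ)) (g z) := by
    rw [← hu]
    exact hasFDerivAt_ringInverse u
  have h2 := h1.comp z g.hasFDerivAt
  refine ⟨_, τ.hasFDerivAt.comp z (((h2.mul_const' a).mul' h2).mul_const' b), fun w => ?_⟩
  rw [← map_add, ← map_neg]
  simp only [ContinuousLinearMap.comp_apply]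
  simp [← hu, mul_assoc]

end Quadratic

lemma OmegaSiegel_eq (v : Fin 2 → SymC d) :
    (fun X : SymC d => OmegaSiegel X v) = fun X =>
      traceCLM d (Ring.inverse (imPartCLM d X) * imPart (v 0) *
        Ring.inverse (imPartCLM d X) * rePart (v 1)) -
      traceCLM d (Ring.inverse (imPartCLM d X) * rePart (v 0) *
        Ring.inverse (imPartCLM d X) * imPart (v 1)) := by
  ext1 X
  rw [OmegaSiegel_apply, im_siegelMetric, nonsing_inv_eq_ringInverse]
  rfl

lemma isUnit_imPart {X : SymC d} (hX : X ∈ Siegel d) : IsUnit (imPart X) :=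
  Matrix.PosDef.isUnit hX

lemma contDiffOn_OmegaSiegel :
    ContDiffOn ℝ ∞ (OmegaSiegel (d := d)) (Siegel d : Set (SymC d)) := by
  refine contDiffOn_of_apply fun v => ?_
  rw [OmegaSiegel_eq]
  intro X hX
  exact ((contDiffAt_ringInverse_mul_mul _ _ _ _ _ (isUnit_imPart hX)).sub
    (contDiffAt_ringInverse_mul_mul _ _ _ _ _ (isUnit_imPart hX))).contDiffWithinAt

lemma fderiv_OmegaSiegel {X : SymC d} (hX : X ∈ Siegel d) (v : Fin 2 → SymC d) (U : SymC d) :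
    fderiv ℝ (fun X : SymC d => OmegaSiegel X v) X U =
      -(((imPart X)⁻¹ * imPart U * ((imPart X)⁻¹ * imPart (v 0)) *
          ((imPart X)⁻¹ * rePart (v 1))).trace +
        ((imPart X)⁻¹ * imPart (v 0) * ((imPart X)⁻¹ * imPart U) *
          ((imPart X)⁻¹ * rePart (v 1))).trace) +
      (((imPart X)⁻¹ * imPart (v 1) * ((imPart X)⁻¹ * imPart U) *
          ((imPart X)⁻¹ * rePart (v 0))).trace +
        ((imPart X)⁻¹ * imPart U * ((imPart X)⁻¹ * imPart (v 1)) *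
          ((imPart X)⁻¹ * rePart (v 0))).trace) := by
  obtain ⟨u, hu⟩ := isUnit_imPart hX
  have hui : ((u⁻¹ : (Matrix (Fin d) (Fin d) ℝ)ˣ) : Matrix (Fin d) (Fin d) ℝ) =
      (imPart X)⁻¹ := by
    rw [← hu, coe_units_inv]
  obtain ⟨L, hL, hLU⟩ := hasFDerivAt_ringInverse_mul_mul (traceCLM d) (imPartCLM d)
    (imPart (v 0)) (rePart (v 1)) X u hu
  obtain ⟨L', hL', hLU'⟩ := hasFDerivAt_ringInverse_mul_mul (traceCLM d) (imPartCLM d)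
    (rePart (v 0)) (imPart (v 1)) X u hu
  rw [OmegaSiegel_eq]
  refine (congrArg (fun L => L U) (hL.sub hL').fderiv).trans ?_
  rw [_root_.sub_apply, hLU, hLU', hui]
  simp only [traceCLM_apply, imPartCLM_apply]
  generalize (imPart X)⁻¹ * imPart U = u2
  generalize (imPart X)⁻¹ * imPart (v 1) = w2
  generalize (imPart X)⁻¹ * rePart (v 0) = v1
  -- Cyclic rotations bring the real-part factor to the last place in every term, so that the terms
  -- of the exterior derivative match literally.
  rw [trace_mul_cycle u2 v1 w2, ← trace_mul_cycle u2 w2 v1]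
  ring

lemma isSymplecticOn_OmegaSiegel :
    IsSymplecticOn (OmegaSiegel (d := d)) (Siegel d : Set (SymC d)) := by
  refine ⟨contDiffOn_OmegaSiegel, fun X hX => ?_, fun X hX V hV => ?_⟩
  · have hd : DifferentiableAt ℝ (OmegaSiegel (d := d)) X :=
      (contDiffOn_OmegaSiegel.contDiffAt ((Siegel d).isOpen.mem_nhds hX)).differentiableAt
        (by simp)
    ext v
    rw [extDeriv_apply hd]
    refine (Fin.sum_univ_three _).trans ?_
    -- Each pair of traces is symmetric in its two imaginary-part factors, so the alternating sum
    -- over three vectors cancels.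
    simp only [fderiv_OmegaSiegel hX, Fin.removeNth]
    simp [Fin.succAbove]
    ring
  · have hB := (isUnit_iff_isUnit_det _).1 (isUnit_imPart hX)
    have hBt := imPart_transpose X
    have hVt := imPart_transpose V
    have hVt' := rePart_transpose V
    -- Conjugating by `ℬ` cancels both `ℬ⁻¹`, and exchanging the parts with a sign makes the pairing
    -- `tr((Im V)²) + tr((Re V)²)`, a sum of nonnegative terms.
    have h := hV (symCMk (imPart X * imPart V * imPart X) (-(imPart X * rePart V * imPart X))
      (by simp only [transpose_mul, hBt, hVt, Matrix.mul_assoc])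
      (by simp only [transpose_neg, transpose_mul, hBt, hVt', Matrix.mul_assoc]))
    rw [OmegaSiegel_apply, im_siegelMetric] at h
    have hc : ∀ A : Matrix (Fin d) (Fin d) ℝ,
        ((imPart X)⁻¹ * A * (imPart X)⁻¹ * (imPart X * A * imPart X)).trace = (A * A).trace := by
      intro A
      rw [show (imPart X)⁻¹ * A * (imPart X)⁻¹ * (imPart X * A * imPart X) =
        (imPart X)⁻¹ * (A * ((imPart X)⁻¹ * imPart X) * A * imPart X) by
          simp only [Matrix.mul_assoc], nonsing_inv_mul _ hB, trace_mul_comm, Matrix.mul_one,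
        Matrix.mul_assoc, mul_nonsing_inv _ hB, Matrix.mul_one]
    simp only [cons_val_zero, cons_val_one, rePart_symCMk, imPart_symCMk, Matrix.mul_neg,
      trace_neg, hc] at h
    have hnn : ∀ A : Matrix (Fin d) (Fin d) ℝ, 0 ≤ (Aᵀ * A).trace := by
      intro A
      simp only [trace, diag, mul_apply, transpose_apply]
      exact Finset.sum_nonneg fun i _ => Finset.sum_nonneg fun j _ => mul_self_nonneg _
    have h1 := hnn (imPart V)
    have h2 := hnn (rePart V)
    rw [hVt] at h1
    rw [hVt'] at h2
    have h3 : imPart V = 0 := eq_zero_of_trace_transpose_mul_self (by rw [hVt]; linarith)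
    have h4 : rePart V = 0 := eq_zero_of_trace_transpose_mul_self (by rw [hVt']; linarith)
    refine Subtype.ext ?_
    rw [symC_eq_re_add_im, h3, h4]
    ext i j
    simp

/-! ### Cayley charts of the level set -/

section Cayley

variable {A : Type*} [Ring A]

lemma ringInverse_eq_of_mul_eq_one {a b : A} (h : a * b = 1) (h' : b * a = 1) :
    Ring.inverse a = b :=
  Ring.inverse_unit ⟨a, b, h, h'⟩

/-- The Cayley transform `X ↦ (1 + X)(1 - X)⁻¹`. -/
def cayley (X : A) : A := (1 + X) * Ring.inverse (1 - X)

/-- The inverse `W ↦ (W - 1)(W + 1)⁻¹` of the Cayley transform. -/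
def cayleyInv (W : A) : A := (W - 1) * Ring.inverse (W + 1)

lemma cayley_zero : cayley (0 : A) = 1 := by simp [cayley]

lemma cayleyInv_one : cayleyInv (1 : A) = 0 := by simp [cayleyInv]

variable [Algebra ℝ A]

lemma smul_mul_smul_of_mul_eq_one {a b : A} (h : a * b = 1) :
    ((2 : ℝ) • a) * ((1 / 2 : ℝ) • b) = 1 := by
  rw [smul_mul_smul_comm, h]
  norm_num

lemma smul_mul_smul_of_mul_eq_one' {a b : A} (h : a * b = 1) :
    ((1 / 2 : ℝ) • a) * ((2 : ℝ) • b) = 1 := by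
  rw [smul_mul_smul_comm, h]
  norm_num

/-- Write `1` as `(1 - X)(1 - X)⁻¹` and combine numerators; the analogous identities below use the
same device. -/
lemma cayley_add_one {X : A} (hX : IsUnit (1 - X)) :
    cayley X + 1 = (2 : ℝ) • Ring.inverse (1 - X) := by
  have h := Ring.mul_inverse_cancel _ hX
  rw [cayley]
  generalize Ring.inverse (1 - X) = r at h
  trans (1 + X) * r + (1 - X) * r
  · rw [h]
  · simp only [two_smul, add_mul, sub_mul, one_mul]
    abel

lemma cayley_sub_one {X : A} (hX : IsUnit (1 - X)) :
    cayley X - 1 = (2 : ℝ) • (X * Ring.inverse (1 - X)) := by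
  have h := Ring.mul_inverse_cancel _ hX
  rw [cayley]
  generalize Ring.inverse (1 - X) = r at h
  trans (1 + X) * r - (1 - X) * r
  · rw [h]
  · simp only [two_smul, add_mul, sub_mul, one_mul]
    abel

lemma isUnit_cayley_add_one {X : A} (hX : IsUnit (1 - X)) : IsUnit (cayley X + 1) := by
  rw [cayley_add_one hX]
  exact ⟨⟨_, _, smul_mul_smul_of_mul_eq_one (Ring.inverse_mul_cancel _ hX),
    smul_mul_smul_of_mul_eq_one' (Ring.mul_inverse_cancel _ hX)⟩, rfl⟩

lemma cayleyInv_cayley {X : A} (hX : IsUnit (1 - X)) : cayleyInv (cayley X) = X := by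
  rw [cayleyInv, cayley_add_one hX, cayley_sub_one hX, ringInverse_eq_of_mul_eq_one
    (smul_mul_smul_of_mul_eq_one (Ring.inverse_mul_cancel _ hX))
    (smul_mul_smul_of_mul_eq_one' (Ring.mul_inverse_cancel _ hX)), smul_mul_smul_comm, mul_assoc,
    Ring.inverse_mul_cancel _ hX]
  norm_num

lemma one_sub_cayleyInv {W : A} (hW : IsUnit (W + 1)) :
    1 - cayleyInv W = (2 : ℝ) • Ring.inverse (W + 1) := by
  have h := Ring.mul_inverse_cancel _ hW
  rw [cayleyInv]
  generalize Ring.inverse (W + 1) = r at h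
  trans (W + 1) * r - (W - 1) * r
  · rw [h]
  · simp only [two_smul, add_mul, sub_mul, one_mul]
    abel

lemma one_add_cayleyInv {W : A} (hW : IsUnit (W + 1)) :
    1 + cayleyInv W = (2 : ℝ) • (W * Ring.inverse (W + 1)) := by
  have h := Ring.mul_inverse_cancel _ hW
  rw [cayleyInv]
  generalize Ring.inverse (W + 1) = r at h
  trans (W + 1) * r + (W - 1) * r
  · rw [h]
  · simp only [two_smul, add_mul, sub_mul, one_mul]
    abel

lemma isUnit_one_sub_cayleyInv {W : A} (hW : IsUnit (W + 1)) : IsUnit (1 - cayleyInv W) := by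
  rw [one_sub_cayleyInv hW]
  exact ⟨⟨_, _, smul_mul_smul_of_mul_eq_one (Ring.inverse_mul_cancel _ hW),
    smul_mul_smul_of_mul_eq_one' (Ring.mul_inverse_cancel _ hW)⟩, rfl⟩

lemma cayley_cayleyInv {W : A} (hW : IsUnit (W + 1)) : cayley (cayleyInv W) = W := by
  rw [cayley, one_sub_cayleyInv hW, one_add_cayleyInv hW, ringInverse_eq_of_mul_eq_one
    (smul_mul_smul_of_mul_eq_one (Ring.inverse_mul_cancel _ hW))
    (smul_mul_smul_of_mul_eq_one' (Ring.mul_inverse_cancel _ hW)), smul_mul_smul_comm, mul_assoc,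
    Ring.inverse_mul_cancel _ hW]
  norm_num

end Cayley

section CayleyCalculus

variable {A : Type*} [NormedRing A] [NormedAlgebra ℝ A] [CompleteSpace A]

lemma contDiffAt_cayley {X : A} (hX : IsUnit (1 - X)) : ContDiffAt ℝ ∞ (cayley (A := A)) X := by
  obtain ⟨u, hu⟩ := hX
  have h0 : ContDiffAt ℝ ∞ (Ring.inverse : A → A) (1 - X) := by
    rw [← hu]
    exact contDiffAt_ringInverse ℝ u
  have h1 : ContDiffAt ℝ ∞ (fun X : A => 1 - X) X := contDiffAt_const.sub contDiffAt_id
  have h2 : ContDiffAt ℝ ∞ (fun X : A => 1 + X) X := contDiffAt_const.add contDiffAt_id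
  exact h2.mul (h0.comp X h1)

lemma contDiffAt_cayleyInv {W : A} (hW : IsUnit (W + 1)) :
    ContDiffAt ℝ ∞ (cayleyInv (A := A)) W := by
  obtain ⟨u, hu⟩ := hW
  have h0 : ContDiffAt ℝ ∞ (Ring.inverse : A → A) (W + 1) := by
    rw [← hu]
    exact contDiffAt_ringInverse ℝ u
  have h1 : ContDiffAt ℝ ∞ (fun X : A => X + 1) W := contDiffAt_id.add contDiffAt_const
  have h2 : ContDiffAt ℝ ∞ (fun X : A => X - 1) W := contDiffAt_id.sub contDiffAt_const
  exact h2.mul (ContDiffAt.comp (f := fun X : A => X + 1) W h0 h1)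

/-- The factor `2` enters both `chartDeriv` and `orbitDeriv`, so it does not affect the comparison
of the two-forms. -/
lemma hasFDerivAt_cayley_zero :
    HasFDerivAt (cayley (A := A)) ((2 : ℝ) • ContinuousLinearMap.id ℝ A) 0 := by
  have h0 : HasFDerivAt (Ring.inverse : A → A)
      (-(ContinuousLinearMap.mulLeftRight ℝ A) ((1 : Aˣ)⁻¹ : Aˣ) ((1 : Aˣ)⁻¹ : Aˣ))
      ((1 : A) - 0) := by
    rw [sub_zero, ← Units.val_one]
    exact hasFDerivAt_ringInverse 1
  have h1 : HasFDerivAt (fun X : A => 1 - X) (-ContinuousLinearMap.id ℝ A) 0 :=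
    (hasFDerivAt_id 0).const_sub 1
  have h2 : HasFDerivAt (fun X : A => 1 + X) (ContinuousLinearMap.id ℝ A) 0 :=
    (hasFDerivAt_id 0).const_add 1
  refine (h2.mul' (h0.comp 0 h1)).congr_fderiv ?_
  ext X
  simp [two_smul]

end CayleyCalculus

/-! ### The Cayley transform between `sp(2d, ℝ)` and `Sp(2d, ℝ)` -/

lemma cayley_mem_symplectic {X : Phase d} (hX : X ∈ spLie d) (hu : IsUnit (1 - X)) :
    (cayley X)ᵀ * (J d : Phase d) * cayley X = (J d : Phase d) := by
  -- The terms linear in `X` cancel because `Xᵀ J + J X = 0`; both sides are even in `X`.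
  have h1 : (1 + X)ᵀ * (J d : Phase d) * (1 + X) = (1 - X)ᵀ * (J d : Phase d) * (1 - X) := by
    simp only [transpose_add, transpose_sub, transpose_one, Matrix.add_mul, Matrix.sub_mul,
      Matrix.mul_add, Matrix.mul_sub, Matrix.one_mul, Matrix.mul_one, spLie_transpose_mul hX]
    abel
  have h2 := Ring.mul_inverse_cancel _ hu
  rw [cayley]
  generalize Ring.inverse (1 - X) = r at h2
  calc ((1 + X) * r)ᵀ * (J d : Phase d) * ((1 + X) * r)
      = rᵀ * ((1 + X)ᵀ * (J d : Phase d) * (1 + X)) * r := by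
        simp only [transpose_mul, Matrix.mul_assoc]
    _ = ((1 - X) * r)ᵀ * (J d : Phase d) * ((1 - X) * r) := by
        rw [h1]
        simp only [transpose_mul, Matrix.mul_assoc]
    _ = _ := by rw [h2, transpose_one, Matrix.one_mul, Matrix.mul_one]

lemma cayleyInv_mem_spLie {W : Phase d}
    (hW : Wᵀ * (J d : Phase d) * W = (J d : Phase d)) (hu : IsUnit (W + 1)) :
    cayleyInv W ∈ spLie d := by
  have h1 : (W - 1)ᵀ * (J d : Phase d) * (W + 1) + (W + 1)ᵀ * (J d : Phase d) * (W - 1) = 0 := by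
    simp only [transpose_add, transpose_sub, transpose_one, Matrix.add_mul, Matrix.sub_mul,
      Matrix.mul_add, Matrix.mul_sub, Matrix.one_mul, Matrix.mul_one, hW]
    abel
  have h2 := Ring.mul_inverse_cancel _ hu
  change (cayleyInv W)ᵀ * (J d : Phase d) + (J d : Phase d) * cayleyInv W = 0
  rw [cayleyInv]
  generalize Ring.inverse (W + 1) = q at h2
  generalize W + 1 = a at h1 h2
  generalize W - 1 = b at h1
  calc (b * q)ᵀ * (J d : Phase d) + (J d : Phase d) * (b * q)
      = (b * q)ᵀ * (J d : Phase d) * (a * q) +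
          (a * q)ᵀ * (J d : Phase d) * (b * q) := by
        rw [h2, transpose_one, Matrix.one_mul, Matrix.mul_one]
    _ = qᵀ * (bᵀ * (J d : Phase d) * a +
          aᵀ * (J d : Phase d) * b) * q := by
        simp only [transpose_mul, Matrix.mul_assoc, Matrix.mul_add, Matrix.add_mul]
    _ = 0 := by rw [h1, Matrix.mul_zero, Matrix.zero_mul]

/-- The projection `X ↦ (X + J Xᵀ J) / 2` onto `sp(2d, ℝ)`. -/
def spProj (d : ℕ) : Phase d →L[ℝ] spLie d :=
  LinearMap.toContinuousLinearMap
    { toFun := fun X => ⟨(1 / 2 : ℝ) • (X + (J d : Phase d) * Xᵀ * (J d : Phase d)), by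
        refine Submodule.smul_mem _ _ ?_
        change (X + (J d : Phase d) * Xᵀ * (J d : Phase d))ᵀ * (J d : Phase d) +
          (J d : Phase d) * (X + (J d : Phase d) * Xᵀ * (J d : Phase d)) = 0
        simp only [transpose_add, transpose_mul, transpose_transpose, J_transpose, Matrix.add_mul,
          Matrix.mul_add, Matrix.neg_mul, Matrix.mul_neg, Matrix.mul_assoc, J_mul_J]
        simp [← Matrix.mul_assoc, J_mul_J]⟩
      map_add' := fun X Y => Subtype.ext (by
        change (1 / 2 : ℝ) • (X + Y + (J d : Phase d) * (X + Y)ᵀ * (J d : Phase d)) =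
          (1 / 2 : ℝ) • (X + (J d : Phase d) * Xᵀ * (J d : Phase d)) +
            (1 / 2 : ℝ) • (Y + (J d : Phase d) * Yᵀ * (J d : Phase d))
        rw [transpose_add, ← smul_add, Matrix.mul_add, Matrix.add_mul]
        congr 1
        abel)
      map_smul' := fun c X => Subtype.ext (by
        change (1 / 2 : ℝ) • (c • X + (J d : Phase d) * (c • X)ᵀ * (J d : Phase d)) =
          c • (1 / 2 : ℝ) • (X + (J d : Phase d) * Xᵀ * (J d : Phase d))
        rw [transpose_smul, Matrix.mul_smul, Matrix.smul_mul, ← smul_add, smul_comm]) }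

/-- The projection makes the chart formula total with values in `spLie d`; on the chart domain it
changes nothing. -/
lemma spProj_of_mem {X : Phase d} (hX : X ∈ spLie d) : spProj d X = ⟨X, hX⟩ := by
  refine Subtype.ext ?_
  change (1 / 2 : ℝ) • (X + (J d : Phase d) * Xᵀ * (J d : Phase d)) = X
  rw [Matrix.mul_assoc, spLie_transpose_mul hX, Matrix.mul_neg, ← Matrix.mul_assoc, J_mul_J,
    Matrix.neg_mul, Matrix.one_mul, neg_neg, ← two_smul ℝ, smul_smul]
  norm_num

namespace LevelSet

variable (S : LevelSet d)

lemma inv_mul_self : (S : Phase d)⁻¹ * (S : Phase d) = 1 :=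
  nonsing_inv_mul _ ((isUnit_iff_isUnit_det _).1 S.isUnit)

lemma mul_inv_self : (S : Phase d) * (S : Phase d)⁻¹ = 1 :=
  mul_nonsing_inv _ ((isUnit_iff_isUnit_det _).1 S.isUnit)

lemma inv_mul_symplectic (T : LevelSet d) :
    ((S : Phase d)⁻¹ * (T : Phase d))ᵀ * (J d : Phase d) * ((S : Phase d)⁻¹ * (T : Phase d)) =
      (J d : Phase d) := by
  have h1 := S.transpose_J_mul
  calc _ = (T : Phase d)ᵀ * ((S : Phase d)⁻¹ᵀ * ((S : Phase d)ᵀ * (J d : Phase d) *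
        (S : Phase d)) * (S : Phase d)⁻¹) * (T : Phase d) := by
        rw [h1]
        simp only [transpose_mul, Matrix.mul_assoc]
    _ = (T : Phase d)ᵀ * (((S : Phase d) * (S : Phase d)⁻¹)ᵀ * (J d : Phase d) *
        ((S : Phase d) * (S : Phase d)⁻¹)) * (T : Phase d) := by
        simp only [transpose_mul, Matrix.mul_assoc]
    _ = _ := by
        rw [S.mul_inv_self, transpose_one, Matrix.one_mul, Matrix.mul_one, T.transpose_J_mul]

/-- The point `S (1 + X)(1 - X)⁻¹` of the level set. -/
def mulCayley (X : spLie d) (hX : IsUnit (1 - (X : Phase d))) : LevelSet d :=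
  ⟨(S : Phase d) * cayley (X : Phase d), momentum_eq_Jdual_iff.2 (by
    rw [transpose_mul, show (cayley (X : Phase d))ᵀ * (S : Phase d)ᵀ * (J d : Phase d) *
      ((S : Phase d) * cayley (X : Phase d)) = (cayley (X : Phase d))ᵀ *
        ((S : Phase d)ᵀ * (J d : Phase d) * (S : Phase d)) * cayley (X : Phase d) by
        simp only [Matrix.mul_assoc], S.transpose_J_mul, cayley_mem_symplectic X.2 hX])⟩

lemma inv_mul_mul_cayley (X : Phase d) :
    (S : Phase d)⁻¹ * ((S : Phase d) * cayley X) = cayley X := by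
  rw [← Matrix.mul_assoc, S.inv_mul_self, Matrix.one_mul]

open Classical in
/-- The Cayley chart `T ↦ (W - 1)(W + 1)⁻¹`, `W = S⁻¹ T`, of the level set around `S`. -/
def cayleyChart : OpenPartialHomeomorph (LevelSet d) (spLie d) where
  toFun T := spProj d (cayleyInv ((S : Phase d)⁻¹ * (T : Phase d)))
  -- Outside the target the value is immaterial, and `S` serves as a default.
  invFun X := if hX : IsUnit (1 - (X : Phase d)) then S.mulCayley X hX else S
  source := {T | IsUnit ((S : Phase d)⁻¹ * (T : Phase d) + 1)}
  target := {X | IsUnit (1 - (X : Phase d))}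
  map_source' T hT := by
    change IsUnit (1 - (spProj d (cayleyInv ((S : Phase d)⁻¹ * (T : Phase d))) : Phase d))
    rw [spProj_of_mem (cayleyInv_mem_spLie (S.inv_mul_symplectic T) hT)]
    exact isUnit_one_sub_cayleyInv hT
  map_target' X hX := by
    rw [dif_pos (by exact hX)]
    change IsUnit ((S : Phase d)⁻¹ * ((S : Phase d) * cayley (X : Phase d)) + 1)
    rw [inv_mul_mul_cayley]
    exact isUnit_cayley_add_one hX
  left_inv' T hT := by
    rw [spProj_of_mem (cayleyInv_mem_spLie (S.inv_mul_symplectic T) hT),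
      dif_pos (isUnit_one_sub_cayleyInv hT)]
    refine Subtype.ext ?_
    change (S : Phase d) * cayley (cayleyInv ((S : Phase d)⁻¹ * (T : Phase d))) = T
    rw [cayley_cayleyInv hT, ← Matrix.mul_assoc, S.mul_inv_self, Matrix.one_mul]
  right_inv' X hX := by
    rw [dif_pos (by exact hX)]
    change spProj d (cayleyInv ((S : Phase d)⁻¹ * ((S : Phase d) * cayley (X : Phase d)))) = X
    rw [inv_mul_mul_cayley, cayleyInv_cayley hX, spProj_of_mem X.2]
  open_source := Units.isOpen.preimage
    (f := fun T : LevelSet d => (S : Phase d)⁻¹ * (T : Phase d) + 1) (by fun_prop)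
  open_target := Units.isOpen.preimage
    (f := fun X : spLie d => 1 - (X : Phase d)) (by fun_prop)
  continuousOn_toFun T hT := by
    have h1 : Continuous fun T : LevelSet d => (S : Phase d)⁻¹ * (T : Phase d) := by fun_prop
    exact ((spProj d).continuous.continuousAt.comp
      ((contDiffAt_cayleyInv hT).continuousAt.comp (f := fun T : LevelSet d =>
        (S : Phase d)⁻¹ * (T : Phase d)) h1.continuousAt)).continuousWithinAt
  continuousOn_invFun := by
    refine (Topology.IsInducing.subtypeVal (t := {Z : Phase d |
      momentum Z = Jdual d})).continuousOn_iff.2 ?_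
    refine ContinuousOn.congr (f := fun X : spLie d => (S : Phase d) * cayley (X : Phase d))
      (continuousOn_const.mul fun X hX => ?_) fun X hX =>
        congrArg Subtype.val (dif_pos (by exact hX))
    exact ((contDiffAt_cayley hX).continuousAt.comp
      (f := fun X : spLie d => (X : Phase d)) continuousAt_subtype_val).continuousWithinAt

lemma cayleyChart_apply (T : LevelSet d) :
    S.cayleyChart T = spProj d (cayleyInv ((S : Phase d)⁻¹ * (T : Phase d))) := rfl

lemma coe_cayleyChart_symm {X : spLie d} (hX : IsUnit (1 - (X : Phase d))) :
    (S.cayleyChart.symm X : Phase d) = (S : Phase d) * cayley (X : Phase d) := by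
  have h : S.cayleyChart.symm X = S.mulCayley X hX := dif_pos hX
  rw [h]
  rfl

lemma mem_cayleyChart_source : S ∈ S.cayleyChart.source := by
  change IsUnit ((S : Phase d)⁻¹ * (S : Phase d) + 1)
  have h := isUnit_cayley_add_one (X := (0 : Phase d)) (by simp)
  rw [S.inv_mul_self]
  rwa [cayley_zero] at h

lemma cayleyChart_self : S.cayleyChart S = 0 := by
  rw [cayleyChart_apply, S.inv_mul_self, cayleyInv_one, map_zero]

/-- The derivative of `X ↦ S (1 + X)(1 - X)⁻¹` at `0`. -/
def chartDeriv : spLie d →L[ℝ] Phase d :=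
  (ContinuousLinearMap.mul ℝ (Phase d) (S : Phase d)).comp
    (((2 : ℝ) • ContinuousLinearMap.id ℝ (Phase d)).comp (spLie d).subtypeL)

lemma chartDeriv_apply (X : spLie d) :
    S.chartDeriv X = (S : Phase d) * (((2 : ℝ) • X : spLie d) : Phase d) := rfl

lemma eventuallyEq_cayleyChart_symm {F : Type*} (g : Phase d → F) :
    (fun X : spLie d => g (S.cayleyChart.symm X : Phase d)) =ᶠ[nhds 0]
      fun X => g ((S : Phase d) * cayley (X : Phase d)) := by
  have h : S.cayleyChart.target ∈ nhds (0 : spLie d) := by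
    refine S.cayleyChart.open_target.mem_nhds ?_
    change IsUnit (1 - ((0 : spLie d) : Phase d))
    simp
  filter_upwards [h] with X hX
  rw [S.coe_cayleyChart_symm hX]

variable {F : Type*} [NormedAddCommGroup F] [NormedSpace ℝ F] {g : Phase d → F}

lemma mul_cayley_zero : (S : Phase d) * cayley ((0 : spLie d) : Phase d) = S := by
  change (S : Phase d) * cayley (0 : Phase d) = S
  rw [cayley_zero, Matrix.mul_one]

lemma contDiffAt_comp_cayleyChart_symm (hg : ContDiffAt ℝ ∞ g (S : Phase d)) :
    ContDiffAt ℝ ∞ (fun X : spLie d => g (S.cayleyChart.symm X : Phase d)) 0 := by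
  refine ContDiffAt.congr_of_eventuallyEq ?_ (S.eventuallyEq_cayleyChart_symm g)
  have h1 : ContDiffAt ℝ ∞ (fun X : spLie d => cayley (X : Phase d)) 0 :=
    ContDiffAt.comp (g := cayley (A := Phase d)) (f := (spLie d).subtypeL) (0 : spLie d)
      (contDiffAt_cayley (by simp)) (spLie d).subtypeL.contDiff.contDiffAt
  have h2 : ContDiffAt ℝ ∞ (fun X : spLie d => (S : Phase d) * cayley (X : Phase d)) 0 :=
    contDiffAt_const.mul h1
  refine ContDiffAt.comp (0 : spLie d) ?_ h2
  rw [mul_cayley_zero]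
  exact hg

lemma hasFDerivAt_comp_cayleyChart_symm (hg : ContDiffAt ℝ ∞ g (S : Phase d)) :
    HasFDerivAt (fun X : spLie d => g (S.cayleyChart.symm X : Phase d))
      ((fderiv ℝ g (S : Phase d)).comp S.chartDeriv) 0 := by
  refine HasFDerivAt.congr_of_eventuallyEq ?_ (S.eventuallyEq_cayleyChart_symm g)
  have h1 : HasFDerivAt (fun X : spLie d => cayley (X : Phase d))
      (((2 : ℝ) • ContinuousLinearMap.id ℝ (Phase d)).comp (spLie d).subtypeL) 0 :=
    HasFDerivAt.comp (g := cayley (A := Phase d)) (f := (spLie d).subtypeL) (0 : spLie d)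
      hasFDerivAt_cayley_zero (spLie d).subtypeL.hasFDerivAt
  have h2 : HasFDerivAt (fun X : spLie d => (S : Phase d) * cayley (X : Phase d))
      S.chartDeriv 0 :=
    HasFDerivAt.comp (g := ContinuousLinearMap.mul ℝ (Phase d) (S : Phase d)) (0 : spLie d)
      (ContinuousLinearMap.hasFDerivAt _) h1
  refine HasFDerivAt.comp (0 : spLie d) ?_ h2
  rw [mul_cayley_zero]
  exact (hg.differentiableAt (by simp)).hasFDerivAt

end LevelSet

/-- The manifold structure of the level set given by the Cayley charts. -/
instance levelSetChartedSpace (d : ℕ) : ChartedSpace (spLie d) (LevelSet d) where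
  atlas := Set.range LevelSet.cayleyChart
  chartAt := LevelSet.cayleyChart
  mem_chart_source := LevelSet.mem_cayleyChart_source
  chart_mem_atlas S := ⟨S, rfl⟩

/-- A transition map is `X ↦ cayleyInv (T⁻¹ S cayley X)`, a composite of maps smooth wherever the
inverses they contain exist. -/
instance isManifold_levelSet (d : ℕ) : IsManifold 𝓘(ℝ, spLie d) ∞ (LevelSet d) := by
  refine isManifold_of_contDiffOn _ _ _ ?_
  rintro _ _ ⟨S, rfl⟩ ⟨T, rfl⟩
  simp only [modelWithCornersSelf_coe, modelWithCornersSelf_coe_symm, Function.id_comp,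
    Function.comp_id, Set.range_id, Set.inter_univ, Set.preimage_id]
  have key : ∀ X ∈ (S.cayleyChart.symm ≫ₕ T.cayleyChart).source,
      IsUnit (1 - (X : Phase d)) ∧
        IsUnit ((T : Phase d)⁻¹ * ((S : Phase d) * cayley (X : Phase d)) + 1) := by
    intro X hX
    rw [OpenPartialHomeomorph.trans_source] at hX
    refine ⟨hX.1, ?_⟩
    have h2 : IsUnit ((T : Phase d)⁻¹ * (S.cayleyChart.symm X : Phase d) + 1) := hX.2
    rwa [S.coe_cayleyChart_symm hX.1] at h2
  have h : ContDiffOn ℝ ∞ (fun X : spLie d => spProj d (cayleyInv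
      ((T : Phase d)⁻¹ * ((S : Phase d) * cayley (X : Phase d)))))
      (S.cayleyChart.symm ≫ₕ T.cayleyChart).source := by
    intro X hX
    obtain ⟨h1, h2⟩ := key X hX
    have h3 : ContDiffAt ℝ ∞ (fun X : spLie d => cayley (X : Phase d)) X :=
      ContDiffAt.comp (g := cayley (A := Phase d)) (f := (spLie d).subtypeL) X
        (contDiffAt_cayley h1) (spLie d).subtypeL.contDiff.contDiffAt
    have h4 : ContDiffAt ℝ ∞ (fun X : spLie d =>
        (T : Phase d)⁻¹ * ((S : Phase d) * cayley (X : Phase d))) X :=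
      contDiffAt_const.mul (contDiffAt_const.mul h3)
    exact ((spProj d).contDiff.contDiffAt.comp X
      ((contDiffAt_cayleyInv h2).comp X h4)).contDiffWithinAt
  refine h.congr fun X hX => ?_
  change spProj d (cayleyInv ((T : Phase d)⁻¹ * (S.cayleyChart.symm X : Phase d))) = _
  rw [S.coe_cayleyChart_symm (key X hX).1]

/-! ### The reduced space as a manifold -/

namespace LevelSet

variable (S : LevelSet d)

/-- The derivative of `S ↦ Ψ_S(iI)` in the Cayley chart at `S`. -/
def orbitDeriv : spLie d →L[ℝ] SymC d :=
  (fderiv ℝ (siegelMap (d := d)) (S : Phase d)).comp S.chartDeriv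

lemma orbitDeriv_apply (X : spLie d) : S.orbitDeriv X = S.tangentMap ((2 : ℝ) • X) := by
  rw [← fderiv_siegelMap_apply]
  rfl

lemma orbitDeriv_surjective : Function.Surjective S.orbitDeriv := by
  intro V
  obtain ⟨X, hX⟩ := S.tangentMap_surjective V
  refine ⟨(1 / 2 : ℝ) • X, ?_⟩
  rw [orbitDeriv_apply, smul_smul]
  norm_num [hX]

lemma chartDeriv_injective : Function.Injective S.chartDeriv := by
  intro X Y h
  rw [chartDeriv_apply, chartDeriv_apply] at h
  exact smul_right_injective (spLie d) (two_ne_zero (α := ℝ))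
    (Subtype.ext (S.isUnit.mul_left_cancel h))

lemma cayleyChart_symm_zero : S.cayleyChart.symm 0 = S := by
  rw [← S.cayleyChart_self, S.cayleyChart.left_inv S.mem_cayleyChart_source]

lemma contDiffAt_toSymC_comp :
    ContDiffAt ℝ ∞ (fun X : spLie d => (S.cayleyChart.symm X).toSymC) 0 := by
  simp only [← siegelMap_coe]
  exact S.contDiffAt_comp_cayleyChart_symm (contDiffAt_siegelMap S.isUnit_den)

lemma hasFDerivAt_toSymC_comp :
    HasFDerivAt (fun X : spLie d => (S.cayleyChart.symm X).toSymC) S.orbitDeriv 0 := by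
  simp only [← siegelMap_coe]
  exact S.hasFDerivAt_comp_cayleyChart_symm (contDiffAt_siegelMap S.isUnit_den)

/-- In the Cayley chart at `S` the orbit map is smooth with surjective derivative, so it maps
neighbourhoods onto neighbourhoods. One inequality is continuity, the other openness. -/
lemma map_nhds_toSymC : Filter.map toSymC (nhds S) = nhds S.toSymC := by
  have h0 : (0 : spLie d) ∈ S.cayleyChart.symm.source := by
    change IsUnit (1 - ((0 : spLie d) : Phase d))
    simp
  have h1 := S.cayleyChart.symm.map_nhds_eq h0
  rw [S.cayleyChart_symm_zero] at h1
  rw [← h1, Filter.map_map]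
  have h2 := (S.contDiffAt_toSymC_comp.hasStrictFDerivAt' S.hasFDerivAt_toSymC_comp
    (by simp)).map_nhds_eq_of_surj (LinearMap.range_eq_top.2 S.orbitDeriv_surjective)
  rw [S.cayleyChart_symm_zero] at h2
  exact h2

end LevelSet

lemma continuous_toSymC : Continuous (LevelSet.toSymC (d := d)) :=
  continuous_iff_continuousAt.2 fun S => S.map_nhds_toSymC.le

lemma isOpenMap_toSymC : IsOpenMap (LevelSet.toSymC (d := d)) :=
  isOpenMap_iff_nhds_le.2 fun S => S.map_nhds_toSymC.ge

/-- The map `[S] ↦ Ψ_S(iI)` into the complex symmetric matrices. -/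
def reducedToSymC : Reduced d → SymC d :=
  Quotient.lift LevelSet.toSymC fun S S' h => (toSymC_eq_iff S S').2 h

lemma continuous_piJ : Continuous (piJ (d := d)) := continuous_quotient_mk'

lemma piJ_surjective : Function.Surjective (piJ (d := d)) := Quotient.exists_rep

/-- Injectivity is the description of the fibres. For openness, the image of `U` is the image under
the open orbit map of the preimage of `U`. -/
lemma isOpenEmbedding_reducedToSymC : Topology.IsOpenEmbedding (reducedToSymC (d := d)) := by
  refine .of_continuous_injective_isOpenMap (continuous_toSymC.quotient_lift _) ?_ ?_
  · intro x y h
    obtain ⟨S, rfl⟩ := piJ_surjective x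
    obtain ⟨S', rfl⟩ := piJ_surjective y
    exact Quotient.sound ((toSymC_eq_iff S S').1 h)
  · intro U hU
    have h : reducedToSymC '' U = LevelSet.toSymC '' (piJ ⁻¹' U) := by
      conv_lhs => rw [← Set.image_preimage_eq U piJ_surjective, Set.image_image]
      rfl
    rw [h]
    exact isOpenMap_toSymC _ (hU.preimage continuous_piJ)

instance nonempty_levelSet (d : ℕ) : Nonempty (LevelSet d) :=
  ⟨⟨1, momentum_eq_Jdual_iff.2 (by simp)⟩⟩

instance nonempty_reduced (d : ℕ) : Nonempty (Reduced d) := (nonempty_levelSet d).map piJ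

/-- The manifold structure of the reduced space, with `[S] ↦ Ψ_S(iI)` as its only chart. -/
instance reducedChartedSpace (d : ℕ) : ChartedSpace (SymC d) (Reduced d) :=
  isOpenEmbedding_reducedToSymC.singletonChartedSpace

instance isManifold_reduced (d : ℕ) : IsManifold 𝓘(ℝ, SymC d) ∞ (Reduced d) :=
  isOpenEmbedding_reducedToSymC.isManifold_singleton

/-! ### Smoothness of the inclusion and of the projection -/

/-- The preferred chart at `S` sends `S` to `0`, so only the derivative of the inverse chart at `0`
is needed. -/
lemma hasMFDerivAt_iJ (S : LevelSet d) :
    HasMFDerivAt 𝓘(ℝ, spLie d) 𝓘(ℝ, Phase d) (iJ (d := d)) S S.chartDeriv := by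
  refine ⟨continuous_subtype_val.continuousAt, ?_⟩
  change HasFDerivWithinAt (fun X : spLie d => (S.cayleyChart.symm X : Phase d)) _
    (Set.range id) (S.cayleyChart S)
  rw [S.cayleyChart_self]
  refine HasFDerivAt.hasFDerivWithinAt ?_
  have h := S.hasFDerivAt_comp_cayleyChart_symm (g := id) contDiffAt_id
  rwa [fderiv_id, ContinuousLinearMap.id_comp] at h

lemma contMDiff_iJ : ContMDiff 𝓘(ℝ, spLie d) 𝓘(ℝ, Phase d) ∞ (iJ (d := d)) := by
  intro S
  refine contMDiffAt_iff.2 ⟨continuous_subtype_val.continuousAt, ?_⟩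
  change ContDiffWithinAt ℝ ∞ (fun X : spLie d => (S.cayleyChart.symm X : Phase d))
    (Set.range id) (S.cayleyChart S)
  rw [S.cayleyChart_self]
  exact (S.contDiffAt_comp_cayleyChart_symm (g := id) contDiffAt_id).contDiffWithinAt

lemma hasMFDerivAt_piJ (S : LevelSet d) :
    HasMFDerivAt 𝓘(ℝ, spLie d) 𝓘(ℝ, SymC d) (piJ (d := d)) S S.orbitDeriv := by
  refine ⟨continuous_piJ.continuousAt, ?_⟩
  change HasFDerivWithinAt (fun X : spLie d => (S.cayleyChart.symm X).toSymC) _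
    (Set.range id) (S.cayleyChart S)
  rw [S.cayleyChart_self]
  exact S.hasFDerivAt_toSymC_comp.hasFDerivWithinAt

lemma contMDiff_toSymC :
    ContMDiff 𝓘(ℝ, spLie d) 𝓘(ℝ, SymC d) ∞ (LevelSet.toSymC (d := d)) := by
  intro S
  refine contMDiffAt_iff.2 ⟨continuous_toSymC.continuousAt, ?_⟩
  change ContDiffWithinAt ℝ ∞ (fun X : spLie d => (S.cayleyChart.symm X).toSymC)
    (Set.range id) (S.cayleyChart S)
  rw [S.cayleyChart_self]
  exact S.contDiffAt_toSymC_comp.contDiffWithinAt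

/-- Read in the only chart of the quotient, the projection is the orbit map. -/
lemma contMDiff_piJ : ContMDiff 𝓘(ℝ, spLie d) 𝓘(ℝ, SymC d) ∞ (piJ (d := d)) :=
  ContMDiff.of_comp_isOpenEmbedding isOpenEmbedding_reducedToSymC contMDiff_toSymC

/-! ### The diffeomorphism onto the Siegel upper half space -/

lemma reducedToSymC_mem (x : Reduced d) : reducedToSymC x ∈ Siegel d := by
  obtain ⟨S, rfl⟩ := piJ_surjective x
  exact S.toSymC_mem_siegel

lemma contMDiff_reducedToSymC :
    ContMDiff 𝓘(ℝ, SymC d) 𝓘(ℝ, SymC d) ∞ (reducedToSymC (d := d)) :=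
  contMDiff_isOpenEmbedding isOpenEmbedding_reducedToSymC

/-- The bijection `[S] ↦ Ψ_S(iI)` of the reduced space onto the Siegel upper half space. -/
def reducedEquivSiegel (d : ℕ) : Reduced d ≃ Siegel d :=
  Equiv.ofBijective (fun x => (⟨reducedToSymC x, reducedToSymC_mem x⟩ : Siegel d))
    ⟨fun _ _ h => isOpenEmbedding_reducedToSymC.injective (congrArg Subtype.val h), fun X => by
      obtain ⟨S, hS⟩ := exists_toSymC_eq X.2
      exact ⟨piJ S, Subtype.ext hS⟩⟩

/-- The diffeomorphism `[S] ↦ Ψ_S(iI)` of the reduced space onto the Siegel upper half space. -/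
def reducedDiffeomorph (d : ℕ) :
    Reduced d ≃ₘ^∞⟮𝓘(ℝ, SymC d), 𝓘(ℝ, SymC d)⟯ Siegel d where
  toEquiv := reducedEquivSiegel d
  contMDiff_toFun :=
    (ContMDiff.subtypeVal_comp_iff (Siegel d) _).1 contMDiff_reducedToSymC
  contMDiff_invFun := by
    refine ContMDiff.of_comp_isOpenEmbedding isOpenEmbedding_reducedToSymC ?_
    have h : reducedToSymC ∘ (reducedEquivSiegel d).symm = Subtype.val := by
      ext1 X
      exact congrArg Subtype.val ((reducedEquivSiegel d).apply_symm_apply X)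
    rw [h]
    exact contMDiff_subtype_val

/-- The chart of the quotient and the diffeomorphism are the same map, so in coordinates the latter
is the identity near the point. -/
lemma hasMFDerivAt_reducedDiffeomorph (x : Reduced d) :
    HasMFDerivAt 𝓘(ℝ, SymC d) 𝓘(ℝ, SymC d) (reducedDiffeomorph d) x
      (ContinuousLinearMap.id ℝ (SymC d)) := by
  refine ⟨(reducedDiffeomorph d).continuous.continuousAt, ?_⟩
  let e := isOpenEmbedding_reducedToSymC.toOpenPartialHomeomorph (reducedToSymC (d := d))
  change HasFDerivWithinAt (fun X : SymC d => reducedToSymC (e.symm X)) _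
    (Set.range id) (reducedToSymC x)
  refine HasFDerivAt.hasFDerivWithinAt ((hasFDerivAt_id _).congr_of_eventuallyEq ?_)
  filter_upwards [isOpenEmbedding_reducedToSymC.isOpen_range.mem_nhds ⟨x, rfl⟩] with X hX
  exact isOpenEmbedding_reducedToSymC.toOpenPartialHomeomorph_right_inv _ hX

/-! ### The reduced two-form -/

lemma OmegaZ_mul_left (S : LevelSet d) (X Y : Phase d) :
    (((S : Phase d) * X)ᵀ * (J d : Phase d) * ((S : Phase d) * Y)).trace =
      (Xᵀ * (J d : Phase d) * Y).trace := by
  conv_rhs => rw [← S.transpose_J_mul]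
  simp only [transpose_mul, Matrix.mul_assoc]

/-- Both derivatives are evaluated on the same vectors `2 X`, so the factor `-2` of
`OmegaSiegel_tangentMap` is compensated by `-1/2`. -/
lemma OmegaSiegel_orbitDeriv (S : LevelSet d) :
    ((-(1 / 2) : ℝ) • OmegaSiegel S.toSymC).compContinuousLinearMap S.orbitDeriv =
      (OmegaZ d).compContinuousLinearMap S.chartDeriv := by
  ext v
  change (-(1 / 2) : ℝ) * OmegaSiegel S.toSymC (fun i => S.orbitDeriv (v i)) =
    OmegaZ d fun i => S.chartDeriv (v i)
  rw [OmegaSiegel_apply, OmegaZ_apply]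
  simp only [S.orbitDeriv_apply, S.chartDeriv_apply]
  rw [OmegaSiegel_tangentMap, OmegaZ_mul_left]
  ring

lemma twoForm_ext_of_surjective {E F : Type*} [NormedAddCommGroup E] [NormedSpace ℝ E]
    [NormedAddCommGroup F] [NormedSpace ℝ F] {L : E →L[ℝ] F} (hL : Function.Surjective L)
    {α β : F [⋀^Fin 2]→L[ℝ] ℝ}
    (h : α.compContinuousLinearMap L = β.compContinuousLinearMap L) : α = β := by
  ext v
  choose w hw using fun i => hL (v i)
  have h1 := congrArg (fun γ => γ w) h
  have h2 : (fun i => L (w i)) = v := funext hw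
  change α (fun i => L (w i)) = β (fun i => L (w i)) at h1
  rwa [h2] at h1

/-- Existence and uniqueness at once: the explicit form has the required pull-back, and surjectivity
of the derivative of the projection determines a form by its pull-back. -/
lemma reduced_twoForm_iff
    (η : (x : Reduced d) → TangentSpace 𝓘(ℝ, SymC d) x [⋀^Fin 2]→L[ℝ] ℝ) :
    (∀ S : LevelSet d,
      (η (piJ S)).compContinuousLinearMap
          (mfderiv 𝓘(ℝ, spLie d) 𝓘(ℝ, SymC d) (piJ (d := d)) S) =
        (OmegaZ d).compContinuousLinearMap
          (mfderiv 𝓘(ℝ, spLie d) 𝓘(ℝ, Phase d) (iJ (d := d)) S)) ↔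
    ∀ x : Reduced d,
      η x = ((-(1 / 2) : ℝ) • OmegaSiegel (reducedDiffeomorph d x : SymC d)).compContinuousLinearMap
        (mfderiv 𝓘(ℝ, SymC d) 𝓘(ℝ, SymC d) (reducedDiffeomorph d) x) := by
  have hid : ∀ x : Reduced d,
      ((-(1 / 2) : ℝ) • OmegaSiegel (reducedDiffeomorph d x : SymC d)).compContinuousLinearMap
        (mfderiv 𝓘(ℝ, SymC d) 𝓘(ℝ, SymC d) (reducedDiffeomorph d) x) =
      (-(1 / 2) : ℝ) • OmegaSiegel (reducedToSymC x) := by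
    intro x
    rw [(hasMFDerivAt_reducedDiffeomorph x).mfderiv]
    rfl
  simp only [hid, (hasMFDerivAt_iJ _).mfderiv, (hasMFDerivAt_piJ _).mfderiv]
  constructor
  · intro h x
    obtain ⟨S, rfl⟩ := piJ_surjective x
    exact twoForm_ext_of_surjective S.orbitDeriv_surjective
      ((h S).trans (OmegaSiegel_orbitDeriv S).symm)
  · intro h S
    rw [h (piJ S)]
    exact OmegaSiegel_orbitDeriv S

end

end SiegelReduction
open SiegelReduction in
theorem theorem3p1 (d : ℕ) :
    -- `Ω = -dΘ` is a symplectic form on the phase space, and `O(2d)` preserves `Θ` and `Ω`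
    (∀ Z : Phase d,
      extDeriv (fun Z' : Phase d =>
        ContinuousAlternatingMap.ofSubsingleton ℝ (Phase d) ℝ (0 : Fin 1) (Theta Z')) Z =
          -OmegaZ d) ∧
    IsSymplecticOn (fun _ : Phase d => OmegaZ d) Set.univ ∧
    (∀ (R : O d) (Z X : Phase d), Theta (Z * (R : Phase d)) (X * (R : Phase d)) = Theta Z X) ∧
    (∀ (R : O d) (X Y : Phase d),
      OmegaZ d ![X * (R : Phase d), Y * (R : Phase d)] = OmegaZ d ![X, Y]) ∧
    -- `M` is an equivariant momentum map of the action, given by the stated blocks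
    (∀ (ξ : o d) (Z : Phase d),
      HasDerivAt (fun ε : ℝ => Z * NormedSpace.exp (ε • (ξ : Phase d))) (generator ξ Z) 0) ∧
    (∀ (ξ : o d) (Z : Phase d),
      DifferentiableAt ℝ (fun Z' : Phase d => momentum Z' ξ) Z ∧
        ∀ X : Phase d, fderiv ℝ (fun Z' : Phase d => momentum Z' ξ) Z X =
          OmegaZ d ![generator ξ Z, X]) ∧
    (∀ (R : O d) (Z : Phase d), momentum (Z * (R : Phase d)) = coAd R (momentum Z)) ∧
    Function.Bijective (toDual (d := d)) ∧
    (∀ Q₁ Q₂ P₁ P₂ : Matrix (Fin d) (Fin d) ℝ,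
      ∃ h : fromBlocks (Q₁ᵀ * P₁ - P₁ᵀ * Q₁) (Q₁ᵀ * P₂ - P₁ᵀ * Q₂)
          (-(Q₁ᵀ * P₂ - P₁ᵀ * Q₂)ᵀ) (Q₂ᵀ * P₂ - P₂ᵀ * Q₂) ∈
            LieAlgebra.Orthogonal.so (Fin d ⊕ Fin d) ℝ,
        momentum (fromBlocks Q₁ Q₂ P₁ P₂) = toDual ⟨_, h⟩) ∧
    -- the level set is `Sp(2d, ℝ)`, and `J` is a regular value
    {Z : Phase d | momentum Z = Jdual d} = (Matrix.symplecticGroup (Fin d) ℝ : Set (Phase d)) ∧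
    (∀ S : LevelSet d, ∀ μ : Module.Dual ℝ (o d), ∃ X : Phase d, ∀ ξ : o d,
      fderiv ℝ (fun Z : Phase d => momentum Z ξ) (S : Phase d) X = μ ξ) ∧
    -- the isotropy group is `Sp(2d, ℝ) ∩ O(2d) ≅ U(d)`; it is compact and acts freely
    (∀ R : O d, R ∈ isotropy d ↔ (R : Phase d) ∈ Matrix.symplecticGroup (Fin d) ℝ) ∧
    (∃ e : isotropy d ≃ₜ* Matrix.unitaryGroup (Fin d) ℂ, ∀ R : isotropy d,
      (e R : Matrix (Fin d) (Fin d) ℂ) =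
        ((R : O d) : Phase d).toBlocks₁₁.map Complex.ofReal +
          Complex.I • ((R : O d) : Phase d).toBlocks₁₂.map Complex.ofReal) ∧
    CompactSpace (isotropy d) ∧
    (∀ S : LevelSet d, ∀ R ∈ isotropy d, (S : Phase d) * (R : Phase d) = (S : Phase d) → R = 1) ∧
    -- the quotient is the homogeneous space `Sp(2d, ℝ) / (Sp(2d, ℝ) ∩ O(2d))`
    (∃ h : Reduced d ≃ₜ Matrix.symplecticGroup (Fin d) ℝ ⧸ spOrthogonal d,
      ∀ (S : LevelSet d) (hS : (S : Phase d) ∈ Matrix.symplecticGroup (Fin d) ℝ),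
        h (piJ S) = QuotientGroup.mk ⟨(S : Phase d), hS⟩) ∧
    -- `Ω_Σ` is a symplectic form on the Siegel upper half space
    IsSymplecticOn (OmegaSiegel (d := d)) (Siegel d : Set (SymC d)) ∧
    -- `M⁻¹(J)` is an embedded submanifold and the quotient is a manifold with `π_J` a submersion;
    -- `[S] ↦ Ψ_S(i I)` is a diffeomorphism of the quotient onto the Siegel upper half space, and the
    -- unique two-form on the quotient whose pull-back by `π_J` is `i_J^* Ω` is `-½ Ω_Σ`
    (∀ S : LevelSet d, IsUnit (denom (S : Phase d) (iI d))) ∧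
    ∃ (_ : ChartedSpace (spLie d) (LevelSet d)) (_ : ChartedSpace (SymC d) (Reduced d)),
      IsManifold 𝓘(ℝ, spLie d) ∞ (LevelSet d) ∧
      IsManifold 𝓘(ℝ, SymC d) ∞ (Reduced d) ∧
      ContMDiff 𝓘(ℝ, spLie d) 𝓘(ℝ, Phase d) ∞ (iJ (d := d)) ∧
      (∀ S : LevelSet d,
        Function.Injective (mfderiv 𝓘(ℝ, spLie d) 𝓘(ℝ, Phase d) (iJ (d := d)) S)) ∧
      ContMDiff 𝓘(ℝ, spLie d) 𝓘(ℝ, SymC d) ∞ (piJ (d := d)) ∧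
      (∀ S : LevelSet d,
        Function.Surjective (mfderiv 𝓘(ℝ, spLie d) 𝓘(ℝ, SymC d) (piJ (d := d)) S)) ∧
      ∃ Φ : Reduced d ≃ₘ^∞⟮𝓘(ℝ, SymC d), 𝓘(ℝ, SymC d)⟯ Siegel d,
        (∀ S : LevelSet d,
          ((Φ (piJ S) : SymC d) : Matrix (Fin d) (Fin d) ℂ) = moebius (S : Phase d) (iI d)) ∧
        ∀ η : (x : Reduced d) → TangentSpace 𝓘(ℝ, SymC d) x [⋀^Fin 2]→L[ℝ] ℝ,
          (∀ S : LevelSet d,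
            (η (piJ S)).compContinuousLinearMap
                (mfderiv 𝓘(ℝ, spLie d) 𝓘(ℝ, SymC d) (piJ (d := d)) S) =
              (OmegaZ d).compContinuousLinearMap
                (mfderiv 𝓘(ℝ, spLie d) 𝓘(ℝ, Phase d) (iJ (d := d)) S)) ↔
          ∀ x : Reduced d,
            η x = ((-(1 / 2) : ℝ) • OmegaSiegel (Φ x : SymC d)).compContinuousLinearMap
              (mfderiv 𝓘(ℝ, SymC d) 𝓘(ℝ, SymC d) Φ x) := by
  refine ⟨extDeriv_Theta, isSymplecticOn_OmegaZ, Theta_mul_orthogonal, OmegaZ_mul_orthogonal,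
    hasDerivAt_mul_exp,
    fun ξ Z => ⟨(hasFDerivAt_momentum ξ Z).differentiableAt, fderiv_momentum_eq_OmegaZ ξ Z⟩,
    momentum_mul_orthogonal, toDual_bijective, momentum_fromBlocks, levelSet_eq, momentum_regular,
    fun R => mem_isotropy_iff, ⟨isotropyEquiv d, fun R => rfl⟩, compactSpace_isotropy d,
    fun S R _ h => isotropy_free S R h, ⟨reducedHomeomorph d, fun S hS => rfl⟩,
    isSymplecticOn_OmegaSiegel, fun S => S.isUnit_den, levelSetChartedSpace d,
    reducedChartedSpace d, isManifold_levelSet d, isManifold_reduced d, contMDiff_iJ, fun S => ?_,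
    contMDiff_piJ, fun S => ?_, reducedDiffeomorph d, fun S => rfl, reduced_twoForm_iff⟩
  · rw [(hasMFDerivAt_iJ S).mfderiv]
    exact S.chartDeriv_injective
  · rw [(hasMFDerivAt_piJ S).mfderiv]
    exact S.orbitDeriv_surjective
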